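/- All graphs are finite and simple. A \emph{circular-arc graph} is the intersection graph of a finite family $\mathcal A$ of (nonempty) arcs on a circle; $\mathcal A$ is then a \emph{circular-arc model} of the graph. A \emph{Helly circular-arc graph} is a graph having a circular-arc model $\mathcal A$ with the Helly property, i.e. such that every nonempty subfamily of pairwise intersecting arcs of $\mathcal A$ has a common point. A \emph{minimal forbidden induced subgraph} for the class of Helly circular-arc graphs is a graph that is not a Helly circular-arc graph but all of whose proper induced subgraphs are Helly circular-arc graphs. For a vertex $y$ of a graph $G$, let $\overline N_G(y)$ be the set of vertices of $G$ different from $y$ and nonadjacent to $y$. An \emph{obstacle enumeration} in $G$ is a circular enumeration $\mathcal Q=v_1,\ldots,v_k$ of $k\ge 3$ pairwise different vertices such that $Q=\{v_1,\ldots,v_k\}$ is a clique of $G$, together with, for each $i$ (indices modulo $k$), a witness enumeration $\mathcal W_i$ which is either - a single vertex $w_i$ with $\overline N_G(w_i)\cap Q=\{v_i,v_{i+1}\}$, or - a pair $u_i,z_i$ of adjacent vertices with $\overline N_G(u_i)\cap Q=\{v_i\}$ and $\overline N_G(z_i)\cap Q=\{v_{i+1}\}$. The vertices occurring in $\mathcal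 W_1,\ldots,\mathcal W_k$ are the \emph{witnesses} of $\mathcal Q$. An edge $y_1y_2$ of $G$ joining two witnesses is \emph{valid} if one of the sets $\overline N_G(y_1)\cap Q$ and $\overline N_G(y_2)\cap Q$ is contained in the other, or if $y_1$ and $y_2$ occur together in some $\mathcal W_i$. The enumeration $\mathcal Q$ (with its witness enumerations) is \emph{essential} if every edge of $G$ joining two witnesses of $\mathcal Q$ is valid. $G$ is an \emph{obstacle} (resp. an \emph{essential obstacle}) if there is an obstacle enumeration (resp. an essential obstacle enumeration) in $G$ such that every vertex of $G$ belongs to $Q$ or is a witness. An obstacle is \emph{minimal} if no proper induced subgraph of it is an obstacle. \textbf{Theorem.} For every finite graph $G$, the following are equivalent: (i) $G$ is a circular-arc graph and a minimal forbidden induced subgraph for the class of Helly circular-arc graphs; (ii) $G$ is an essential obstacle; (iii) $G$ is a minimal obstacle and a circular-arc graph. -/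

import Mathlib

universe u

/-! ### Circular-arc graphs and Helly circular-arc graphs -/

/-- An arc on the circle `ℝ / ℤ`: the image of a nonempty interval of `ℝ` (of any kind: open,
closed or half-open) under the projection.  In particular an arc is nonempty. -/
def IsArc (A : Set UnitAddCircle) : Prop :=
  ∃ I : Set ℝ, I.Nonempty ∧ I.OrdConnected ∧ A = (fun x : ℝ => (x : UnitAddCircle)) '' I

/-- The family of arcs `A`, one arc for each vertex, is a circular-arc model of `G`: two different
vertices are adjacent if and only if their arcs meet. -/
def IsCircularArcModel {V : Type u} (G : SimpleGraph V) (A : V → Set UnitAddCircle) : Prop :=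
  (∀ v, IsArc (A v)) ∧ ∀ u v, u ≠ v → (G.Adj u v ↔ (A u ∩ A v).Nonempty)

/-- The Helly property: every nonempty subfamily of pairwise intersecting sets has nonempty total
intersection. -/
def IsHellyFamily {ι : Type u} {X : Type*} (A : ι → Set X) : Prop :=
  ∀ S : Set ι, S.Nonempty → (∀ i ∈ S, ∀ j ∈ S, (A i ∩ A j).Nonempty) →
    (⋂ i ∈ S, A i).Nonempty

def IsCircularArcGraph {V : Type u} (G : SimpleGraph V) : Prop :=
  ∃ A : V → Set UnitAddCircle, IsCircularArcModel G A

def IsHellyCircularArcGraph {V : Type u} (G : SimpleGraph V) : Prop :=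
  ∃ A : V → Set UnitAddCircle, IsCircularArcModel G A ∧ IsHellyFamily A

/-- `G` is a minimal forbidden induced subgraph for the graph class `P`: it is not in the class,
but all its proper induced subgraphs are. -/
def IsMinimalForbiddenInducedSubgraph (P : ∀ {W : Type u}, SimpleGraph W → Prop)
    {V : Type u} (G : SimpleGraph V) : Prop :=
  ¬ P G ∧ ∀ S : Set V, S ≠ Set.univ → P (G.induce S)

/-! ### Obstacles -/

/-- A linear enumeration of one or two vertices. -/
inductive WitnessEnumeration (V : Type u) : Type u where
  | single (w : V)
  | pair (u z : V)

/-- The set of vertices occurring in a witness enumeration. -/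
def WitnessEnumeration.verts {V : Type u} : WitnessEnumeration V → Set V
  | .single w => {w}
  | .pair u z => {u, z}

/-- `W` can serve as the witness enumeration of the edge `a b` for the core `Q` in `G`.  The set of
vertices different from `y` and nonadjacent to `y` is `Gᶜ.neighborSet y`. -/
def WitnessEnumeration.IsWitness {V : Type u} (G : SimpleGraph V) (Q : Set V) (a b : V) :
    WitnessEnumeration V → Prop
  | .single w => Gᶜ.neighborSet w ∩ Q = {a, b}
  | .pair u z => Gᶜ.neighborSet u ∩ Q = {a} ∧ Gᶜ.neighborSet z ∩ Q = {b} ∧ G.Adj u z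

/-- An obstacle enumeration in `G`, with its witness enumerations; indices are modulo `k`. -/
structure ObstacleEnumeration {V : Type u} (G : SimpleGraph V) where
  k : ℕ
  three_le : 3 ≤ k
  v : ZMod k → V
  injective : Function.Injective v
  isClique : G.IsClique (Set.range v)
  W : ZMod k → WitnessEnumeration V
  isWitness : ∀ i, (W i).IsWitness G (Set.range v) (v i) (v (i + 1))

namespace ObstacleEnumeration

variable {V : Type u} {G : SimpleGraph V}

/-- The core of the enumeration. -/
def core (Q : ObstacleEnumeration G) : Set V := Set.range Q.v

/-- The set of witnesses of the enumeration. -/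
def witnesses (Q : ObstacleEnumeration G) : Set V := ⋃ i, (Q.W i).verts

/-- `Q` is an obstacle enumeration *of* `G`, not just in `G`: it involves all the vertices. -/
def IsSpanning (Q : ObstacleEnumeration G) : Prop := Q.core ∪ Q.witnesses = Set.univ

/-- Validity of the edge `y₁ y₂` joining two witnesses. -/
def IsValid (Q : ObstacleEnumeration G) (y₁ y₂ : V) : Prop :=
  Gᶜ.neighborSet y₁ ∩ Q.core ⊆ Gᶜ.neighborSet y₂ ∩ Q.core ∨
  Gᶜ.neighborSet y₂ ∩ Q.core ⊆ Gᶜ.neighborSet y₁ ∩ Q.core ∨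
  ∃ i, y₁ ∈ (Q.W i).verts ∧ y₂ ∈ (Q.W i).verts

/-- Every edge joining two witnesses is valid. -/
def IsEssential (Q : ObstacleEnumeration G) : Prop :=
  ∀ y₁ ∈ Q.witnesses, ∀ y₂ ∈ Q.witnesses, G.Adj y₁ y₂ → Q.IsValid y₁ y₂

end ObstacleEnumeration

def IsObstacle {V : Type u} (G : SimpleGraph V) : Prop :=
  ∃ Q : ObstacleEnumeration G, Q.IsSpanning

def IsEssentialObstacle {V : Type u} (G : SimpleGraph V) : Prop :=
  ∃ Q : ObstacleEnumeration G, Q.IsSpanning ∧ Q.IsEssential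

/-- A minimal obstacle: an obstacle containing no induced obstacle having fewer vertices (for
finite graphs, no proper induced subgraph is an obstacle). -/
def IsMinimalObstacle {V : Type u} (G : SimpleGraph V) : Prop :=
  IsObstacle G ∧ ∀ S : Set V, S ≠ Set.univ → ¬ IsObstacle (G.induce S)

/-!
The theorem rests on four facts about an obstacle enumeration `Q` with core `v₁, …, v_k`.

*Obstacles are not Helly* (`ObstacleEnumeration.not_isHellyCircularArcGraph`).  In a Helly model,
the clique formed by the witnesses of `vᵢ vᵢ₊₁` and the other core vertices has a common point `xᵢ`, and
`xᵢ` misses exactly the arcs of `vᵢ` and `vᵢ₊₁`.  Cutting the circle at a common point of the core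
turns the complements of the core arcs into intervals of a line; the `i`-th one contains exactly the
points `xᵢ₋₁` and `xᵢ`, so that these are consecutive on the line.  The leftmost of the points would
then have two different successors.

*Circular-arc graphs that are not Helly contain essential obstacles*
(`IsCircularArcGraph.exists_isEssential`).  Among the models by closed arcs, one with the largest
number of pairs of arcs covering the circle is chosen.  It has a minimal clique without common
point; the complements of its arcs ("gaps") cover the circle, in cyclic order, and only
consecutive ones overlap (`exists_cyclicGaps`).  Extending two consecutive arcs of the clique into
the overlap of their gaps until they touch would produce one more covering pair, so the extension
is blocked by other arcs.  A blocking arc within the overlap is a single witness, and otherwise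
two blocking arcs, one for each side, meet and are a witness pair.  For this fixed core, a choice
of witnesses having the fewest vertices is essential (`exists_isEssential_of_witnesses`).

*Essential obstacles are circular-arc graphs* (`ObstacleEnumeration.IsEssential.exists_model`).  By
essentiality, apart from the edges between core and witnesses, the only edges at a witness join it
to its partner in a pair or to a witness at the next or previous place in the cyclic order; so the
witnesses can be drawn as short arcs around the overlaps of the gaps of the core.

*Proper induced subgraphs of essential obstacles are Helly*
(`ObstacleEnumeration.IsEssential.isHelly_induce`).  In the model just described every clique other
than the core has a common point, and the core gets one when one of its vertices is removed, or
when a witness is removed and the arcs it blocked are extended.  The exception is three pairwise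
adjacent witnesses; then the graph is the octahedron, where core and witnesses can change roles.
-/

/-! ### Obstacle enumerations -/

namespace ObstacleEnumeration

variable {V : Type u} {G : SimpleGraph V} (Q : ObstacleEnumeration G)

lemma two_ne_zero : (2 : ZMod Q.k) ≠ 0 := by
  have h := Q.three_le
  have : ((2 : ℕ) : ZMod Q.k) ≠ 0 := by
    rw [Ne, ZMod.natCast_eq_zero_iff]
    exact fun h2 => absurd (Nat.le_of_dvd (by norm_num) h2) (by omega)
  exact_mod_cast this

lemma one_ne_zero : (1 : ZMod Q.k) ≠ 0 := by
  intro h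
  apply Q.two_ne_zero
  rw [show (2 : ZMod Q.k) = 1 + 1 by norm_num, h, add_zero]

lemma add_one_ne (i : ZMod Q.k) : i + 1 ≠ i := by
  simpa using Q.one_ne_zero

lemma add_two_ne (i : ZMod Q.k) : i + 1 + 1 ≠ i := by
  intro h
  apply Q.two_ne_zero
  linear_combination h

lemma ne_v {T : Set V} (hT : T.Nonempty) {y : V} (h : Gᶜ.neighborSet y ∩ Q.core = T)
    (j : ZMod Q.k) : y ≠ Q.v j := by
  rintro rfl
  obtain ⟨t, ht⟩ := hT
  rw [← h] at ht
  obtain ⟨h1, ⟨l, rfl⟩⟩ := ht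
  rw [SimpleGraph.mem_neighborSet, SimpleGraph.compl_adj] at h1
  exact h1.2 (Q.isClique ⟨j, rfl⟩ ⟨l, rfl⟩ h1.1)

lemma adj_v_iff {T : Set V} (hT : T.Nonempty) {y : V} (h : Gᶜ.neighborSet y ∩ Q.core = T)
    (j : ZMod Q.k) : G.Adj y (Q.v j) ↔ Q.v j ∉ T := by
  have h1 := Q.ne_v hT h j
  rw [← h]
  have h2 : Q.v j ∈ Q.core := ⟨j, rfl⟩
  simp [h2, SimpleGraph.compl_adj, h1]

lemma conbr_single {i : ZMod Q.k} {w : V} (h : Q.W i = .single w) :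
    Gᶜ.neighborSet w ∩ Q.core = {Q.v i, Q.v (i + 1)} := by
  have := Q.isWitness i
  rw [h] at this
  exact this

lemma conbr_left {i : ZMod Q.k} {y z : V} (h : Q.W i = .pair y z) :
    Gᶜ.neighborSet y ∩ Q.core = {Q.v i} := by
  have := Q.isWitness i
  rw [h] at this
  exact this.1

lemma conbr_right {i : ZMod Q.k} {y z : V} (h : Q.W i = .pair y z) :
    Gᶜ.neighborSet z ∩ Q.core = {Q.v (i + 1)} := by
  have := Q.isWitness i
  rw [h] at this
  exact this.2.1

lemma adj_pair {i : ZMod Q.k} {y z : V} (h : Q.W i = .pair y z) : G.Adj y z := by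
  have := Q.isWitness i
  rw [h] at this
  exact this.2.2

lemma single_ne_v {i : ZMod Q.k} {w : V} (h : Q.W i = .single w) (j : ZMod Q.k) : w ≠ Q.v j :=
  Q.ne_v (Set.insert_nonempty _ _) (Q.conbr_single h) j

lemma adj_single_iff {i : ZMod Q.k} {w : V} (h : Q.W i = .single w) (j : ZMod Q.k) :
    G.Adj w (Q.v j) ↔ j ≠ i ∧ j ≠ i + 1 := by
  rw [Q.adj_v_iff (Set.insert_nonempty _ _) (Q.conbr_single h)]
  simp [Q.injective.eq_iff]

lemma adj_v_iff_ne {i : ZMod Q.k} {y : V} (h : Gᶜ.neighborSet y ∩ Q.core = {Q.v i})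
    (j : ZMod Q.k) : G.Adj y (Q.v j) ↔ j ≠ i := by
  rw [Q.adj_v_iff (Set.singleton_nonempty _) h]
  simp [Q.injective.eq_iff]

lemma v_pair_ne (i j : ZMod Q.k) : ({Q.v i, Q.v (i + 1)} : Set V) ≠ {Q.v j} := by
  intro h
  have h1 : Q.v i ∈ ({Q.v j} : Set V) := h ▸ Or.inl rfl
  have h2 : Q.v (i + 1) ∈ ({Q.v j} : Set V) := h ▸ Or.inr rfl
  exact Q.add_one_ne i (Q.injective (h2.trans h1.symm))

lemma v_pair_inj {i j : ZMod Q.k} (h : ({Q.v i, Q.v (i + 1)} : Set V) = {Q.v j, Q.v (j + 1)}) :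
    i = j := by
  have h1 : Q.v i ∈ ({Q.v j, Q.v (j + 1)} : Set V) := h ▸ Or.inl rfl
  have h2 : Q.v (i + 1) ∈ ({Q.v j, Q.v (j + 1)} : Set V) := h ▸ Or.inr rfl
  rcases h1 with h1 | h1
  · exact Q.injective h1
  · have h3 := Q.injective h1
    rcases h2 with h2 | h2
    · have h4 := Q.injective h2
      rw [h3] at h4
      exact absurd h4 (Q.add_two_ne j)
    · exact absurd (Q.injective (h2.trans h1.symm)) (Q.add_one_ne i)

/-- A witness whose only non-neighbour in the core is `v i` can only occur as the first vertex of
the pair at `i`, or as the second vertex of the pair at `i - 1`. -/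
lemma mem_verts_cases {i j : ZMod Q.k} {y : V} (h : Gᶜ.neighborSet y ∩ Q.core = {Q.v i})
    (hy : y ∈ (Q.W j).verts) :
    (j = i ∧ ∃ z, Q.W j = .pair y z) ∨ (j + 1 = i ∧ ∃ z, Q.W j = .pair z y) := by
  cases hj : Q.W j with
  | single w =>
    rw [hj] at hy
    obtain rfl : y = w := hy
    exact absurd ((Q.conbr_single hj).symm.trans h) (Q.v_pair_ne _ _)
  | pair a b =>
    rw [hj] at hy
    rcases hy with rfl | rfl
    · have := (Q.conbr_left hj).symm.trans h
      exact Or.inl ⟨Q.injective (by simpa using this), b, rfl⟩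
    · have := (Q.conbr_right hj).symm.trans h
      exact Or.inr ⟨Q.injective (by simpa using this), a, rfl⟩

lemma eq_single_of_mem_verts {i j : ZMod Q.k} {y : V}
    (h : Gᶜ.neighborSet y ∩ Q.core = {Q.v i, Q.v (i + 1)}) (hy : y ∈ (Q.W j).verts) :
    j = i ∧ Q.W j = .single y := by
  cases hj : Q.W j with
  | single w =>
    rw [hj] at hy
    obtain rfl : y = w := hy
    exact ⟨Q.v_pair_inj ((Q.conbr_single hj).symm.trans h), rfl⟩
  | pair a b =>
    rw [hj] at hy
    rcases hy with rfl | rfl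
    · exact absurd (h.symm.trans (Q.conbr_left hj)) (Q.v_pair_ne _ _)
    · exact absurd (h.symm.trans (Q.conbr_right hj)) (Q.v_pair_ne _ _)

/-- Every witness misses two consecutive core vertices, and is then a single witness, or misses just
one core vertex. -/
lemma witness_cases {y : V} (hy : y ∈ Q.witnesses) :
    (∃ i, Q.W i = .single y) ∨ ∃ i, Gᶜ.neighborSet y ∩ Q.core = {Q.v i} := by
  obtain ⟨i, hi⟩ := Set.mem_iUnion.1 hy
  cases h : Q.W i with
  | single w =>
    rw [h] at hi
    obtain rfl : y = w := hi
    exact Or.inl ⟨i, h⟩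
  | pair a b =>
    rw [h] at hi
    rcases hi with rfl | rfl
    · exact Or.inr ⟨_, Q.conbr_left h⟩
    · exact Or.inr ⟨_, Q.conbr_right h⟩

/-- The witnesses of the `i`-th edge form a clique, and a core vertex is complete to it if and only
if it is not an end of that edge. -/
lemma exists_clique (i : ZMod Q.k) : (Q.W i).verts.Nonempty ∧ G.IsClique (Q.W i).verts ∧
    (∀ y ∈ (Q.W i).verts, ∀ j, y ≠ Q.v j) ∧
    ∀ j, (∀ y ∈ (Q.W i).verts, G.Adj y (Q.v j)) ↔ j ≠ i ∧ j ≠ i + 1 := by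
  cases h : Q.W i with
  | single w =>
    refine ⟨⟨w, rfl⟩, ?_, ?_, ?_⟩
    · simp [WitnessEnumeration.verts]
    · rintro y rfl j
      exact Q.single_ne_v h j
    · intro j
      simp [WitnessEnumeration.verts, Q.adj_single_iff h]
  | pair y z =>
    refine ⟨⟨y, Or.inl rfl⟩, ?_, ?_, ?_⟩
    · simp only [WitnessEnumeration.verts, SimpleGraph.isClique_pair]
      exact fun _ => Q.adj_pair h
    · rintro x (rfl | rfl) j
      · exact Q.ne_v (Set.singleton_nonempty _) (Q.conbr_left h) j
      · exact Q.ne_v (Set.singleton_nonempty _) (Q.conbr_right h) j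
    · intro j
      simp [WitnessEnumeration.verts, Q.adj_v_iff_ne (Q.conbr_left h),
        Q.adj_v_iff_ne (Q.conbr_right h)]

end ObstacleEnumeration

/-! ### An obstacle has no Helly model -/

namespace UnitAddCircle

lemma coe_eq_coe_iff {x y : ℝ} : (x : UnitAddCircle) = y ↔ ∃ m : ℤ, x = y + m := by
  rw [← sub_eq_zero, ← AddCircle.coe_sub, AddCircle.coe_eq_zero_iff]
  simp only [zsmul_eq_mul, mul_one]
  exact exists_congr fun m => ⟨fun h => by linarith, fun h => by linarith⟩

lemma coe_add_int (x : ℝ) (m : ℤ) : ((x + m : ℝ) : UnitAddCircle) = x :=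
  coe_eq_coe_iff.2 ⟨m, rfl⟩

end UnitAddCircle

/-- After cutting the circle at a point `p` of an arc, the complement of the arc is convex. -/
lemma IsArc.notMem_of_between {A : Set UnitAddCircle} (hA : IsArc A) {p x y z : ℝ}
    (hp : (p : UnitAddCircle) ∈ A) (hpx : p < x) (hxy : x < y) (hyz : y < z) (hz : z < p + 1)
    (hx : (x : UnitAddCircle) ∉ A) (hz' : (z : UnitAddCircle) ∉ A) :
    (y : UnitAddCircle) ∉ A := by
  obtain ⟨I, -, hI, rfl⟩ := hA
  rintro ⟨y', hy', hyy⟩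
  obtain ⟨p', hp', hpp⟩ := hp
  obtain ⟨m, rfl⟩ := UnitAddCircle.coe_eq_coe_iff.1 hyy
  obtain ⟨n, rfl⟩ := UnitAddCircle.coe_eq_coe_iff.1 hpp
  -- An interval from a lift of `p` to a lift of `y` contains a lift of `x` or of `z`.
  rcases le_or_gt n m with h | h
  · have h' : (n : ℝ) ≤ m := by exact_mod_cast h
    exact hx ⟨x + m, hI.out hp' hy' ⟨by linarith, by linarith⟩, UnitAddCircle.coe_add_int x m⟩
  · have h' : (m : ℝ) + 1 ≤ n := by exact_mod_cast h
    exact hz' ⟨z + m, hI.out hy' hp' ⟨by linarith, by linarith⟩, UnitAddCircle.coe_add_int z m⟩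

namespace ObstacleEnumeration

variable {V : Type u} {G : SimpleGraph V} (Q : ObstacleEnumeration G)

/-- In a Helly model there is a point that misses precisely the arcs of the ends of the `i`-th edge
of the core. -/
lemma exists_point {A : V → Set UnitAddCircle} (hA : IsCircularArcModel G A)
    (hH : IsHellyFamily A) (i : ZMod Q.k) :
    ∃ x : UnitAddCircle, ∀ j, x ∈ A (Q.v j) ↔ j ≠ i ∧ j ≠ i + 1 := by
  obtain ⟨hne, hcl, hv, hadj⟩ := Q.exists_clique i
  have inter : ∀ a b, (a ≠ b → G.Adj a b) → (A a ∩ A b).Nonempty := by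
    intro a b hab
    by_cases h : a = b
    · obtain ⟨I, hI, -, hI'⟩ := hA.1 b
      rw [h, Set.inter_self, hI']
      exact hI.image _
    · exact (hA.2 a b h).1 (hab h)
  obtain ⟨x, hx⟩ := hH ((Q.W i).verts ∪ Q.v '' {j | j ≠ i ∧ j ≠ i + 1}) (hne.mono (by simp)) (by
    rintro a (ha | ⟨j, hj, rfl⟩) b (hb | ⟨l, hl, rfl⟩)
    · exact inter a b (hcl ha hb)
    · exact inter a _ fun _ => (hadj l).2 hl a ha
    · exact inter _ b fun _ => ((hadj j).2 hj b hb).symm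
    · exact inter _ _ (Q.isClique ⟨j, rfl⟩ ⟨l, rfl⟩))
  simp only [Set.mem_iInter] at hx
  refine ⟨x, fun j => ⟨fun hj => ?_, fun hj => hx _ (Or.inr ⟨j, hj, rfl⟩)⟩⟩
  rw [← hadj]
  intro y hy
  exact (hA.2 y _ (hv y hy j)).2 ⟨x, hx _ (Or.inl hy), hj⟩

/-- The core of an obstacle enumeration cannot be realized by arcs with the Helly property. -/
theorem not_isHellyCircularArcGraph (Q : ObstacleEnumeration G) : ¬ IsHellyCircularArcGraph G := by
  rintro ⟨A, hA, hH⟩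
  have : NeZero Q.k := ⟨by have := Q.three_le; omega⟩
  obtain ⟨p, hp⟩ := hH (Set.range Q.v) ⟨_, ⟨0, rfl⟩⟩ (by
    rintro _ ⟨i, rfl⟩ _ ⟨j, rfl⟩
    by_cases h : Q.v i = Q.v j
    · obtain ⟨I, hI, -, hI'⟩ := hA.1 (Q.v j)
      rw [h, Set.inter_self, hI']
      exact hI.image _
    · exact (hA.2 _ _ h).1 (Q.isClique ⟨i, rfl⟩ ⟨j, rfl⟩ h))
  simp only [Set.mem_iInter] at hp
  replace hp : ∀ j, p ∈ A (Q.v j) := fun j => hp _ ⟨j, rfl⟩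
  choose x hx using Q.exists_point hA hH
  obtain ⟨p, rfl⟩ := QuotientAddGroup.mk_surjective p
  change ∀ j, (p : UnitAddCircle) ∈ _ at hp
  -- Lifts of the points `x i` to the open interval obtained by cutting the circle at `p`.
  have lift : ∀ i, ∃ X : ℝ, (X : UnitAddCircle) = x i ∧ p < X ∧ X < p + 1 := by
    intro i
    obtain ⟨y, hy⟩ := QuotientAddGroup.mk_surjective (x i)
    change (y : UnitAddCircle) = x i at hy
    refine ⟨y + (-⌊y - p⌋ : ℤ), by rw [UnitAddCircle.coe_add_int, hy], ?_, ?_⟩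
    · have h1 := Int.floor_le (y - p)
      push_cast
      refine lt_of_le_of_ne (by linarith) fun h => ?_
      have h2 : (p : UnitAddCircle) = y := by
        rw [UnitAddCircle.coe_eq_coe_iff]
        exact ⟨-⌊y - p⌋, by push_cast; exact h⟩
      have h3 := hp i
      rw [h2, hy, hx] at h3
      exact h3.1 rfl
    · have h1 := Int.lt_floor_add_one (y - p)
      push_cast
      linarith
  choose X hX hXp hXq using lift
  have conv : ∀ {a b c : ZMod Q.k} (j : ZMod Q.k), X a < X b → X b < X c →
      (j = a ∨ j = a + 1) → (j = c ∨ j = c + 1) → (j = b ∨ j = b + 1) := by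
    intro a b c j hab hbc ha hc
    have := (hA.1 (Q.v j)).notMem_of_between (hp j) (hXp a) hab hbc (hXq c)
      (by rw [hX, hx]; tauto) (by rw [hX, hx]; tauto)
    rw [hX, hx] at this
    tauto
  have inj : Function.Injective X := by
    intro a b hab
    have h1 : ∀ j, (j ≠ a ∧ j ≠ a + 1) ↔ (j ≠ b ∧ j ≠ b + 1) := by
      intro j
      rw [← hx, ← hx, ← hX, ← hX, hab]
    by_contra h
    have h2 : a = b + 1 := by have := h1 a; tauto
    have h3 : b = a + 1 := by have := h1 b; tauto
    exact Q.add_two_ne b (by rw [← h2, ← h3])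
  -- Both neighbours of the leftmost lift would have to be next to it.
  obtain ⟨a, ha⟩ := Finite.exists_min X
  have n1 : a - 1 ≠ a := fun h => Q.add_one_ne (a - 1) (by rw [sub_add_cancel]; exact h.symm)
  have n2 : a - 1 ≠ a + 1 := fun h => Q.add_two_ne (a - 1) (by rw [sub_add_cancel, h])
  have l1 : X a < X (a + 1) := lt_of_le_of_ne (ha _) (inj.ne (Q.add_one_ne a).symm)
  have l2 : X a < X (a - 1) := lt_of_le_of_ne (ha _) (inj.ne n1.symm)
  rcases lt_or_gt_of_ne (inj.ne n2) with h | h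
  · rcases conv (a + 1) l2 h (Or.inr rfl) (Or.inl rfl) with h | h
    · exact n2 h.symm
    · rw [sub_add_cancel] at h
      exact Q.add_one_ne a h
  · rcases conv a l1 h (Or.inl rfl) (Or.inr (by rw [sub_add_cancel])) with h | h
    · exact Q.add_one_ne a h.symm
    · exact Q.add_two_ne a h.symm

/-- An obstacle enumeration all of whose vertices lie in `S` is one of the subgraph induced
by `S`. -/
lemma exists_induce {S : Set V} (hS : Q.core ∪ Q.witnesses = S) (hE : Q.IsEssential) :
    IsEssentialObstacle (G.induce S) := by
  have hv : ∀ i, Q.v i ∈ S := fun i => hS ▸ Or.inl ⟨i, rfl⟩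
  have hW : ∀ i, ∃ W : WitnessEnumeration S,
      (∀ y : S, y ∈ W.verts ↔ (y : V) ∈ (Q.W i).verts) ∧
      W.IsWitness (G.induce S) (Set.range fun i => (⟨Q.v i, hv i⟩ : S)) ⟨Q.v i, hv i⟩
        ⟨Q.v (i + 1), hv (i + 1)⟩ := by
    intro i
    have hw : ∀ y ∈ (Q.W i).verts, y ∈ S := fun y hy => hS ▸ Or.inr (Set.mem_iUnion_of_mem i hy)
    have key : ∀ y : S, ∀ T : Set S, Gᶜ.neighborSet (y : V) ∩ Q.core = (↑) '' T →
        (G.induce S)ᶜ.neighborSet y ∩ Set.range (fun i => (⟨Q.v i, hv i⟩ : S)) = T := by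
      intro y T hT
      ext z
      have := Set.ext_iff.1 hT z
      simpa [SimpleGraph.compl_adj, core, ← Subtype.coe_inj] using this
    have hWi := Q.isWitness i
    cases h : Q.W i with
    | single w =>
      rw [h] at hw hWi
      refine ⟨.single ⟨w, hw w rfl⟩, ?_, ?_⟩
      · simp [WitnessEnumeration.verts, ← Subtype.coe_inj]
      · exact key _ _ (by rw [Set.image_pair]; exact hWi)
    | pair y z =>
      rw [h] at hw hWi
      refine ⟨.pair ⟨y, hw y (Or.inl rfl)⟩ ⟨z, hw z (Or.inr rfl)⟩, ?_, ?_, ?_, ?_⟩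
      · simp [WitnessEnumeration.verts, ← Subtype.coe_inj]
      · exact key _ _ (by rw [Set.image_singleton]; exact hWi.1)
      · exact key _ _ (by rw [Set.image_singleton]; exact hWi.2.1)
      · exact hWi.2.2
  choose W hWv hWw using hW
  let Q' : ObstacleEnumeration (G.induce S) :=
    { k := Q.k
      three_le := Q.three_le
      v := fun i => ⟨Q.v i, hv i⟩
      injective := fun i j hij => Q.injective (congrArg Subtype.val hij)
      isClique := by
        rintro _ ⟨i, rfl⟩ _ ⟨j, rfl⟩ hij
        exact Q.isClique ⟨i, rfl⟩ ⟨j, rfl⟩ fun h => hij (Subtype.ext h)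
      W := W
      isWitness := hWw }
  have hc : ∀ y : S, y ∈ Q'.core ↔ (y : V) ∈ Q.core := by
    intro y
    simp [core, Q', ← Subtype.coe_inj]
  have hw : ∀ y : S, y ∈ Q'.witnesses ↔ (y : V) ∈ Q.witnesses := by
    intro y
    simp [witnesses, Q', hWv]
  have hsub : ∀ y₁ y₂ : S, Gᶜ.neighborSet (y₁ : V) ∩ Q.core ⊆ Gᶜ.neighborSet (y₂ : V) ∩ Q.core →
      (G.induce S)ᶜ.neighborSet y₁ ∩ Q'.core ⊆ (G.induce S)ᶜ.neighborSet y₂ ∩ Q'.core := by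
    rintro y₁ y₂ h z ⟨hz, hz'⟩
    have := @h z ⟨by simpa [SimpleGraph.compl_adj, ← Subtype.coe_inj] using hz, (hc z).1 hz'⟩
    exact ⟨by simpa [SimpleGraph.compl_adj, ← Subtype.coe_inj] using this.1, hz'⟩
  refine ⟨Q', ?_, ?_⟩
  · refine Set.eq_univ_of_forall fun y => ?_
    have : (y : V) ∈ Q.core ∪ Q.witnesses := hS.symm ▸ y.2
    exact this.imp (hc y).2 (hw y).2
  · intro y₁ h₁ y₂ h₂ h
    rcases hE y₁ ((hw _).1 h₁) y₂ ((hw _).1 h₂) h with h | h | ⟨i, hi₁, hi₂⟩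
    · exact Or.inl (hsub _ _ h)
    · exact Or.inr (Or.inl (hsub _ _ h))
    · exact Or.inr (Or.inr ⟨i, (hWv i _).2 hi₁, (hWv i _).2 hi₂⟩)

end ObstacleEnumeration

/-! ### From witnesses to an essential obstacle enumeration -/

/-- Suppose that the cyclically enumerated clique `v` has witnesses for all its edges, and that each
point is missed by at most two consecutive arcs of `v`.  Among all choices of witnesses, one with
the fewest witness vertices is essential: the two ends of an invalid edge could serve together as a
witness pair, which would free another witness. -/
theorem exists_isEssential_of_witnesses {V : Type u} [Finite V] {G : SimpleGraph V} {X : Type*}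
    (M : V → X → Prop) (hM : ∀ u w, u ≠ w → (G.Adj u w ↔ ∃ x, M u x ∧ M w x))
    {k : ℕ} (hk : 3 ≤ k) (v : ZMod k → V) (hv : Function.Injective v)
    (hcl : G.IsClique (Set.range v))
    (hW : ∀ i, ∃ W : WitnessEnumeration V, W.IsWitness G (Set.range v) (v i) (v (i + 1)))
    (hM2 : ∀ x, ∃ n, ∀ j, ¬ M (v j) x → j = n ∨ j = n + 1) :
    ∃ Q : ObstacleEnumeration G, Q.IsEssential := by
  classical
  choose W₀ hW₀ using hW
  obtain ⟨W, hW, hmin⟩ := (measure fun W : ZMod k → WitnessEnumeration V =>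
    (⋃ i, (W i).verts).ncard).wf.has_min
    {W | ∀ i, (W i).IsWitness G (Set.range v) (v i) (v (i + 1))} ⟨W₀, hW₀⟩
  let Q : ObstacleEnumeration G := ⟨k, hk, v, hv, hcl, W, hW⟩
  -- The replacement step.
  have key : ∀ n : ZMod k, ∀ y₁ ∈ Q.witnesses, ∀ y₂ ∈ Q.witnesses, G.Adj y₁ y₂ →
      Gᶜ.neighborSet y₁ ∩ Q.core = {v n} → Gᶜ.neighborSet y₂ ∩ Q.core = {v (n + 1)} →
      W n = .pair y₁ y₂ := by
    intro n y₁ h₁ y₂ h₂ h12 hc₁ hc₂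
    by_contra hne
    let W' := Function.update W n (.pair y₁ y₂)
    have hW' : ∀ i, (W' i).IsWitness G (Set.range v) (v i) (v (i + 1)) := by
      intro i
      by_cases hi : i = n
      · subst hi
        simp only [W', Function.update_self]
        exact ⟨hc₁, hc₂, h12⟩
      · simp only [W', Function.update_of_ne hi]
        exact hW i
    refine hmin W' hW' (Set.ncard_lt_ncard ?_ (Set.toFinite _))
    have mem' : ∀ x ∈ ⋃ i, (W' i).verts, x = y₁ ∨ x = y₂ ∨ ∃ j, j ≠ n ∧ x ∈ (W j).verts := by
      intro x hx
      obtain ⟨i, hi⟩ := Set.mem_iUnion.1 hx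
      by_cases hin : i = n
      · subst hin
        simp only [W', Function.update_self] at hi
        exact hi.imp id Or.inl
      · simp only [W', Function.update_of_ne hin] at hi
        exact Or.inr (Or.inr ⟨i, hin, hi⟩)
    have hsub : (⋃ i, (W' i).verts) ⊆ ⋃ i, (W i).verts := by
      intro x hx
      rcases mem' x hx with rfl | rfl | ⟨j, -, hj⟩
      · exact h₁
      · exact h₂
      · exact Set.mem_iUnion_of_mem j hj
    have hvn : ({v n} : Set V) ≠ {v (n + 1)} := by
      intro h
      exact Q.add_one_ne n (hv (by simpa using h.symm))
    refine ⟨hsub, fun hsup => ?_⟩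
    cases hn : W n with
    | single w =>
      have hc := Q.conbr_single hn
      rcases mem' w (hsup (Set.mem_iUnion_of_mem n (by rw [hn]; rfl))) with rfl | rfl | ⟨j, hj, hw⟩
      · exact Q.v_pair_ne _ _ (hc.symm.trans hc₁)
      · exact Q.v_pair_ne _ _ (hc.symm.trans hc₂)
      · exact hj (Q.eq_single_of_mem_verts hc hw).1
    | pair a b =>
      have ha := Q.conbr_left hn
      have hb := Q.conbr_right hn
      obtain ⟨i₁, hi₁⟩ := Set.mem_iUnion.1 h₁
      obtain ⟨i₂, hi₂⟩ := Set.mem_iUnion.1 h₂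
      have haeq : a = y₁ := by
        rcases mem' a (hsup (Set.mem_iUnion_of_mem n (by rw [hn]; exact Or.inl rfl))) with
          h | rfl | ⟨j, hj, hw⟩
        · exact h
        · exact absurd (ha.symm.trans hc₂) hvn
        · rcases Q.mem_verts_cases ha hw with ⟨h, -⟩ | ⟨h, c, hc⟩
          · exact absurd h hj
          · rcases Q.mem_verts_cases hc₁ hi₁ with ⟨rfl, d, hd⟩ | ⟨h', d, hd⟩
            · have := hn.symm.trans hd
              simp at this
              exact this.1
            · obtain rfl : j = i₁ := add_right_cancel (h.trans h'.symm)
              have := hc.symm.trans hd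
              simp at this
              exact this.2
      have hbeq : b = y₂ := by
        rcases mem' b (hsup (Set.mem_iUnion_of_mem n (by rw [hn]; exact Or.inr rfl))) with
          rfl | h | ⟨j, hj, hw⟩
        · exact absurd (hc₁.symm.trans hb) hvn
        · exact h
        · rcases Q.mem_verts_cases hb hw with ⟨h, c, hc⟩ | ⟨h, -⟩
          · rcases Q.mem_verts_cases hc₂ hi₂ with ⟨h', d, hd⟩ | ⟨h', d, hd⟩
            · obtain rfl : j = i₂ := h.trans h'.symm
              have := hc.symm.trans hd
              simp at this
              exact this.1
            · obtain rfl : i₂ = n := add_right_cancel h'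
              have := hn.symm.trans hd
              simp at this
              exact this.2
          · exact absurd (add_right_cancel h) hj
      exact hne (by rw [hn, haeq, hbeq])
  refine ⟨Q, fun y₁ h₁ y₂ h₂ h12 => ?_⟩
  obtain ⟨x, hx₁, hx₂⟩ := (hM y₁ y₂ h12.ne).1 h12
  obtain ⟨n, hn⟩ := hM2 x
  have miss : ∀ y, M y x → ∀ j, v j ∈ Gᶜ.neighborSet y ∩ Q.core → j = n ∨ j = n + 1 := by
    rintro y hy j ⟨hj, -⟩
    rw [SimpleGraph.mem_neighborSet, SimpleGraph.compl_adj] at hj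
    exact hn j fun h => hj.2 ((hM _ _ hj.1).2 ⟨x, hy, h⟩)
  have sub : ∀ y z, M y x → M z x → (∃ i, Q.W i = .single y) →
      Gᶜ.neighborSet z ∩ Q.core ⊆ Gᶜ.neighborSet y ∩ Q.core := by
    rintro y z hy hz ⟨i, hi⟩ _ ⟨ht, j, rfl⟩
    have hj := miss z hz j ⟨ht, j, rfl⟩
    have hc := Q.conbr_single hi
    have e1 := miss y hy i (by rw [hc]; exact Or.inl rfl)
    have e2 := miss y hy (i + 1) (by rw [hc]; exact Or.inr rfl)
    have e3 := Q.add_one_ne i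
    have e4 := Q.add_two_ne n
    obtain rfl : i = n := by
      rcases e1 with e1 | e1
      · exact e1
      · rcases e2 with e2 | e2
        · rw [e1] at e2
          exact absurd e2 e4
        · exact add_right_cancel e2
    rw [hc]
    exact hj.imp (congrArg v) (congrArg v)
  rcases Q.witness_cases h₁ with h | ⟨a, ha⟩
  · exact Or.inr (Or.inl (sub _ _ hx₁ hx₂ h))
  rcases Q.witness_cases h₂ with h | ⟨b, hb⟩
  · exact Or.inl (sub _ _ hx₂ hx₁ h)
  by_cases hab : a = b
  · subst hab
    exact Or.inl (by rw [ha, hb])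
  have e1 := miss y₁ hx₁ a (by rw [ha]; rfl)
  have e2 := miss y₂ hx₂ b (by rw [hb]; rfl)
  refine Or.inr (Or.inr ⟨n, ?_⟩)
  rcases e1 with rfl | rfl <;> rcases e2 with rfl | rfl
  · exact absurd rfl hab
  · have : Q.W a = _ := key a _ h₁ _ h₂ h12 ha hb
    rw [this]
    exact ⟨Or.inl rfl, Or.inr rfl⟩
  · have : Q.W b = _ := key b _ h₂ _ h₁ h12.symm hb ha
    rw [this]
    exact ⟨Or.inr rfl, Or.inl rfl⟩
  · exact absurd rfl hab

/-! ### Closed models -/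

/-- The point of the circle represented by `x : ℝ` lies on the arc represented by the closed
interval `[a, b]`. -/
def OnArc (a b x : ℝ) : Prop := ∃ m : ℤ, a ≤ x + m ∧ x + m ≤ b

lemma OnArc.add_int {a b x : ℝ} (h : OnArc a b x) (n : ℤ) : OnArc a b (x + n) := by
  obtain ⟨m, h1, h2⟩ := h
  exact ⟨m - n, by push_cast; linarith, by push_cast; linarith⟩

lemma onArc_add_int_iff {a b x : ℝ} (n : ℤ) : OnArc a b (x + n) ↔ OnArc a b x :=
  ⟨fun h => by simpa using h.add_int (-n), fun h => h.add_int n⟩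

lemma coe_mem_image_Icc {a b x : ℝ} :
    (x : UnitAddCircle) ∈ (fun t : ℝ => (t : UnitAddCircle)) '' Set.Icc a b ↔ OnArc a b x := by
  constructor
  · rintro ⟨y, hy, hyx⟩
    obtain ⟨m, rfl⟩ := UnitAddCircle.coe_eq_coe_iff.1 hyx
    exact ⟨m, hy.1, hy.2⟩
  · rintro ⟨m, h1, h2⟩
    exact ⟨x + m, ⟨h1, h2⟩, UnitAddCircle.coe_add_int x m⟩

/-- The arcs represented by the closed intervals `[a v, b v]` form a model of `G`. -/
structure IsClosedModel {V : Type u} (G : SimpleGraph V) (a b : V → ℝ) : Prop where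
  le : ∀ v, a v ≤ b v
  adj_iff : ∀ u v, u ≠ v → (G.Adj u v ↔ ∃ x, OnArc (a u) (b u) x ∧ OnArc (a v) (b v) x)

/-- In a model of a finite graph each arc may be shrunk to the closed hull, within the arc, of
finitely many points, one for each pair of meeting arcs. -/
lemma IsCircularArcGraph.exists_isClosedModel {V : Type u} [Finite V] {G : SimpleGraph V}
    (h : IsCircularArcGraph G) : ∃ a b : V → ℝ, IsClosedModel G a b := by
  classical
  obtain ⟨A, hA, hadj⟩ := h
  choose I hne hI hAI using hA
  have hq : ∀ e : V × V, ∃ x : UnitAddCircle, (A e.1 ∩ A e.2).Nonempty → x ∈ A e.1 ∩ A e.2 := by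
    intro e
    by_cases h : (A e.1 ∩ A e.2).Nonempty
    · exact ⟨h.some, fun _ => h.some_mem⟩
    · exact ⟨0, fun h' => absurd h' h⟩
  choose q hq using hq
  have hr : ∀ v (e : V × V), ∃ r ∈ I v, q e ∈ A v → (r : UnitAddCircle) = q e := by
    intro v e
    by_cases h : q e ∈ A v
    · have h' := h
      rw [hAI] at h'
      obtain ⟨r, hr, hrq⟩ := h'
      exact ⟨r, hr, fun _ => hrq⟩
    · exact ⟨(hne v).some, (hne v).some_mem, fun h' => absurd h' h⟩
  choose r hrI hrq using hr
  have hmin : ∀ v, ∃ e₀, ∀ e, r v e₀ ≤ r v e := fun v =>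
    have : Nonempty (V × V) := ⟨(v, v)⟩
    Finite.exists_min (r v)
  have hmax : ∀ v, ∃ e₀, ∀ e, r v e ≤ r v e₀ := fun v =>
    have : Nonempty (V × V) := ⟨(v, v)⟩
    Finite.exists_max (r v)
  choose f hf using hmin
  choose g hg using hmax
  have hsub : ∀ v x, OnArc (r v (f v)) (r v (g v)) x → (x : UnitAddCircle) ∈ A v := by
    rintro v x ⟨m, h1, h2⟩
    rw [hAI]
    exact ⟨x + m, (hI v).out (hrI _ _) (hrI _ _) ⟨h1, h2⟩, UnitAddCircle.coe_add_int x m⟩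
  refine ⟨fun v => r v (f v), fun v => r v (g v), fun v => hf v _, fun u v huv => ?_⟩
  rw [hadj u v huv]
  constructor
  · intro h
    have h1 := hq (u, v) h
    have h2 := hrq u (u, v) h1.1
    have h3 := hrq v (u, v) h1.2
    refine ⟨r u (u, v), ⟨0, by simpa using hf u _, by simpa using hg u _⟩, ?_⟩
    obtain ⟨m, hm⟩ := UnitAddCircle.coe_eq_coe_iff.1 (h3.trans h2.symm)
    exact ⟨m, hm ▸ hf v _, hm ▸ hg v _⟩
  · rintro ⟨x, h1, h2⟩
    exact ⟨x, hsub u x h1, hsub v x h2⟩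

/-- A closed model without Helly property contains pairwise intersecting arcs without a common
point. -/
lemma IsClosedModel.exists_of_not_isHelly {V : Type u} {G : SimpleGraph V} {a b : V → ℝ}
    (h : IsClosedModel G a b) (hG : ¬ IsHellyCircularArcGraph G) :
    ∃ S : Set V,
      (∀ u ∈ S, ∀ v ∈ S, ∃ x, OnArc (a u) (b u) x ∧ OnArc (a v) (b v) x) ∧
      ∀ x, ∃ v ∈ S, ¬ OnArc (a v) (b v) x := by
  have key : ∀ u v, ((fun t : ℝ => (t : UnitAddCircle)) '' Set.Icc (a u) (b u) ∩
      (fun t : ℝ => (t : UnitAddCircle)) '' Set.Icc (a v) (b v)).Nonempty ↔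
      ∃ x, OnArc (a u) (b u) x ∧ OnArc (a v) (b v) x := by
    intro u v
    constructor
    · rintro ⟨y, h1, h2⟩
      obtain ⟨x, rfl⟩ := QuotientAddGroup.mk_surjective y
      exact ⟨x, coe_mem_image_Icc.1 h1, coe_mem_image_Icc.1 h2⟩
    · rintro ⟨x, h1, h2⟩
      exact ⟨x, coe_mem_image_Icc.2 h1, coe_mem_image_Icc.2 h2⟩
  by_contra hcon
  push Not at hcon
  refine hG ⟨fun v => (fun t : ℝ => (t : UnitAddCircle)) '' Set.Icc (a v) (b v), ⟨fun v =>
    ⟨Set.Icc (a v) (b v), Set.nonempty_Icc.2 (h.le v), Set.ordConnected_Icc, rfl⟩,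
    fun u v huv => ?_⟩, fun S _ hpair => ?_⟩
  · rw [key, h.adj_iff u v huv]
  · obtain ⟨x, hx⟩ := hcon S fun u hu v hv => (key u v).1 (hpair u hu v hv)
    refine ⟨x, Set.mem_iInter₂.2 fun v hv => coe_mem_image_Icc.2 (hx v hv)⟩

/-! ### A minimal clique without common point -/

/-- Let `S` be a family of pairwise meeting sets without common point on the circle, given by their
preimages `M v` in `ℝ`.  A minimal subfamily without common point has at least three
members, and for each of them there is a point contained in all the other members.  Enumerating the
members in the cyclic order of these points, and unrolling the circle, gives `v` and `P`. -/
lemma exists_cyclic_sequence {V : Type u} [Finite V] (M : V → ℝ → Prop)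
    (hM : ∀ v x (m : ℤ), M v (x + m) ↔ M v x) (S : Set V)
    (hpair : ∀ u ∈ S, ∀ v ∈ S, ∃ x, M u x ∧ M v x) (hno : ∀ x, ∃ v ∈ S, ¬ M v x) :
    ∃ (k : ℕ) (v : ℤ → V) (P : ℤ → ℝ), 3 ≤ k ∧ (∀ n n', v n = v n' ↔ (k : ℤ) ∣ n' - n) ∧
      StrictMono P ∧ (∀ n m : ℤ, P (n + m * k) = P n + m) ∧
      (∀ n n', M (v n) (P n') ↔ v n ≠ v n') ∧ (∀ n, v n ∈ S) ∧ ∀ x, ∃ n, ¬ M (v n) x := by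
  classical
  obtain ⟨T, ⟨hTS, hT⟩, hmin⟩ := (measure fun T : Set V => T.ncard).wf.has_min
    {T | T ⊆ S ∧ ∀ x, ∃ v ∈ T, ¬ M v x} ⟨S, subset_rfl, hno⟩
  have hp : ∀ v, ∃ x : ℝ, v ∈ T → 0 ≤ x ∧ x < 1 ∧ ∀ u ∈ T, u ≠ v → M u x := by
    intro v
    by_cases hv : v ∈ T
    · have h1 : ¬ ∀ x, ∃ u ∈ T \ {v}, ¬ M u x := fun h =>
        hmin (T \ {v}) ⟨Set.sdiff_subset.trans hTS, h⟩ (Set.ncard_sdiff_singleton_lt_of_mem hv)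
      push Not at h1
      obtain ⟨x, hx⟩ := h1
      refine ⟨Int.fract x, fun _ => ⟨Int.fract_nonneg x, Int.fract_lt_one x, fun u hu huv => ?_⟩⟩
      rw [← hM u _ ⌊x⌋, Int.fract_add_floor]
      exact hx u ⟨hu, huv⟩
    · exact ⟨0, fun h => absurd h hv⟩
  choose p hp using hp
  have hpv : ∀ v ∈ T, ¬ M v (p v) := by
    intro v hv h
    obtain ⟨u, hu, hux⟩ := hT (p v)
    by_cases huv : u = v
    · exact hux (huv ▸ h)
    · exact hux ((hp v hv).2.2 u hu huv)
  have hinj : ∀ u ∈ T, ∀ v ∈ T, p u = p v → u = v := by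
    intro u hu v hv h
    by_contra huv
    exact hpv u hu (h ▸ (hp v hv).2.2 u hu huv)
  have henum : ∃ (k : ℕ) (w : Fin k → V), (∀ i, w i ∈ T) ∧ StrictMono (fun i => p (w i)) ∧
      ∀ v ∈ T, ∃ i, w i = v := by
    let F : Finset ℝ := T.toFinite.toFinset.image p
    have hw : ∀ i : Fin F.card, ∃ v ∈ T, p v = F.orderEmbOfFin rfl i := by
      intro i
      obtain ⟨v, hv, h⟩ := Finset.mem_image.1 (F.orderEmbOfFin_mem rfl i)
      exact ⟨v, by simpa using hv, h⟩
    choose w hwT hw using hw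
    refine ⟨F.card, w, hwT, fun i j hij => ?_, fun v hv => ?_⟩
    · simp only [hw]
      exact (F.orderEmbOfFin rfl).strictMono hij
    · have : p v ∈ Set.range (F.orderEmbOfFin rfl) := by
        rw [Finset.range_orderEmbOfFin]
        simp only [F, Finset.coe_image, Set.Finite.coe_toFinset]
        exact ⟨v, hv, rfl⟩
      obtain ⟨i, hi⟩ := this
      exact ⟨i, hinj _ (hwT i) _ hv ((hw i).trans hi)⟩
  obtain ⟨k, w, hwT, hmono, hsurj⟩ := henum
  have hcov : ∀ x, ∃ i, ¬ M (w i) x := by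
    intro x
    obtain ⟨v, hv, hx⟩ := hT x
    obtain ⟨i, rfl⟩ := hsurj v hv
    exact ⟨i, hx⟩
  have hk : 3 ≤ k := by
    by_contra hk
    have : k = 0 ∨ k = 1 ∨ k = 2 := by omega
    rcases this with rfl | rfl | rfl
    · exact (hcov 0).choose.elim0
    · obtain ⟨x, hx, -⟩ := hpair _ (hTS (hwT 0)) _ (hTS (hwT 0))
      obtain ⟨i, hi⟩ := hcov x
      exact hi (by rwa [Subsingleton.elim i 0])
    · obtain ⟨x, hx, hx'⟩ := hpair _ (hTS (hwT 0)) _ (hTS (hwT 1))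
      obtain ⟨i, hi⟩ := hcov x
      fin_cases i
      · exact hi hx
      · exact hi hx'
  have hk0 : (0 : ℤ) < k := by omega
  let r : ℤ → Fin k := fun n => ⟨(n % k).toNat, by
    have := Int.emod_nonneg n hk0.ne'
    have := Int.emod_lt_of_pos n hk0
    omega⟩
  have hr : ∀ n, ((r n : ℕ) : ℤ) = n % k := fun n =>
    Int.toNat_of_nonneg (Int.emod_nonneg n hk0.ne')
  have hreq : ∀ n n', r n = r n' ↔ (k : ℤ) ∣ n' - n := by
    intro n n'
    rw [← Int.modEq_iff_dvd, Fin.ext_iff, ← Int.natCast_inj, hr, hr]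
    rfl
  have hwinj : Function.Injective w := fun i j hij => hmono.injective (congrArg p hij)
  have hv : ∀ n n', w (r n) = w (r n') ↔ (k : ℤ) ∣ n' - n := by
    intro n n'
    rw [hwinj.eq_iff, hreq]
  have hMP : ∀ i j, M (w i) (p (w j)) ↔ w i ≠ w j := by
    intro i j
    constructor
    · rintro h h'
      exact hpv _ (hwT j) (h' ▸ h)
    · exact (hp _ (hwT j)).2.2 _ (hwT i)
  refine ⟨k, fun n => w (r n), fun n => p (w (r n)) + (n / k : ℤ), hk, hv, ?_, ?_, ?_,
    fun n => hTS (hwT _), ?_⟩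
  · refine strictMono_int_of_lt_succ fun n => ?_
    have h1 := hr n
    have h2 := hr (n + 1)
    have h3 := Int.emod_add_mul_ediv n k
    have h4 := Int.emod_nonneg n hk0.ne'
    have h5 := Int.emod_lt_of_pos n hk0
    by_cases hlast : n % k + 1 = k
    · have h6 : (n + 1) / k = n / k + 1 := by
        rw [show n + 1 = 0 + (n / k + 1) * k by linarith, Int.add_mul_ediv_right _ _ hk0.ne']
        simp
      rw [h6]
      have h7 := (hp _ (hwT (r n))).2.1
      have h8 := (hp _ (hwT (r (n + 1)))).1
      push_cast
      linarith
    · have h6 : (n + 1) / k = n / k := by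
        rw [show n + 1 = (n % k + 1) + (n / k) * k by linarith,
          Int.add_mul_ediv_right _ _ hk0.ne', Int.ediv_eq_zero_of_lt (by omega) (by omega),
          zero_add]
      have h7 : (n + 1) % k = n % k + 1 := by
        have := Int.emod_add_mul_ediv (n + 1) k
        rw [h6] at this
        linarith
      rw [h6]
      have : r n < r (n + 1) := by
        rw [Fin.lt_def]
        omega
      have := hmono this
      simp only at this ⊢
      linarith
  · intro n m
    have h1 : r (n + m * k) = r n := (hreq _ _).2 ⟨-m, by ring⟩
    have h2 : (n + m * k) / k = n / k + m := Int.add_mul_ediv_right _ _ hk0.ne'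
    simp only [h1, h2]
    push_cast
    ring
  · intro n n'
    rw [hM]
    exact hMP _ _
  · intro x
    obtain ⟨i, hi⟩ := hcov x
    refine ⟨(i : ℕ), ?_⟩
    have : r ((i : ℕ) : ℤ) = i := by
      rw [Fin.ext_iff, ← Int.natCast_inj, hr]
      exact Int.emod_eq_of_lt (by omega) (by have := i.2; omega)
    simpa only [this] using hi

/-! ### The gaps of a minimal clique without common point -/

/-- The point represented by a real number outside an arc has a lift to the open interval between
the arc and its translate. -/
lemma exists_lift_of_not_onArc {a b x : ℝ} (h : ¬ OnArc a b x) :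
    ∃ m : ℤ, b - 1 < x + m ∧ x + m < a := by
  have h1 := Int.floor_le (x - a)
  have h2 := Int.lt_floor_add_one (x - a)
  refine ⟨-⌊x - a⌋ - 1, ?_, by push_cast; linarith⟩
  by_contra h3
  push_cast at h3
  exact h ⟨-⌊x - a⌋, by push_cast; linarith, by push_cast; linarith⟩

/-- The cyclic sequence `v` of vertices, of period `k`, unrolled along `ℤ`, together with lifts
`(s n, t n)` to `ℝ` of the complements of the arcs of the `v n`.  These complements cover the
circle, and only consecutive ones meet.  The integer `c n` relates the lift to the closed
interval representing the arc. -/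
structure CyclicGaps {V : Type u} (a b : V → ℝ) where
  k : ℕ
  v : ℤ → V
  s : ℤ → ℝ
  t : ℤ → ℝ
  c : ℤ → ℤ
  three_le : 3 ≤ k
  v_eq_iff : ∀ n n', v n = v n' ↔ (k : ℤ) ∣ n' - n
  a_eq : ∀ n, a (v n) = t n - c n
  b_eq : ∀ n, b (v n) = s n + 1 - c n
  s_lt : ∀ n, s n < s (n + 1)
  t_lt : ∀ n, t n < t (n + 1)
  overlap : ∀ n, s (n + 1) < t n
  next_le : ∀ n, t (n + 1) ≤ s n + 1
  two : ∀ x, ∃ n, ∀ j, ¬ OnArc (a (v j)) (b (v j)) x → v j = v n ∨ v j = v (n + 1)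
  other : ∀ n x, s (n + 1) < x → x < t n → ∀ j, v j ≠ v n → v j ≠ v (n + 1) →
    OnArc (a (v j)) (b (v j)) x

lemma exists_cyclicGaps {V : Type u} [Finite V] {a b : V → ℝ} (hab : ∀ v, a v ≤ b v) (S : Set V)
    (hpair : ∀ u ∈ S, ∀ v ∈ S, ∃ x, OnArc (a u) (b u) x ∧ OnArc (a v) (b v) x)
    (hno : ∀ x, ∃ v ∈ S, ¬ OnArc (a v) (b v) x) :
    ∃ C : CyclicGaps a b, ∀ n, C.v n ∈ S := by
  obtain ⟨k, v, P, hk, hv, hP, hPk, hM, hvS, hcov⟩ := exists_cyclic_sequence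
    (fun v => OnArc (a v) (b v)) (fun v x m => onArc_add_int_iff m) S hpair hno
  have hne : ∀ n (d : ℤ), 0 < d → d < 3 → v n ≠ v (n + d) := by
    intro n d hd hd' h
    rw [hv] at h
    have := Int.le_of_dvd (by linarith) h
    omega
  have hlift : ∀ n, ∃ m : ℤ, b (v n) + m - 1 < P n ∧ P n < a (v n) + m := by
    intro n
    have h : ¬ OnArc (a (v n)) (b (v n)) (P n) := by simp [hM]
    obtain ⟨m, h1, h2⟩ := exists_lift_of_not_onArc h
    exact ⟨-m, by push_cast; linarith, by push_cast; linarith⟩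
  choose c hcb hca using hlift
  obtain ⟨s, hs⟩ : ∃ s : ℤ → ℝ, s = fun n => b (v n) + c n - 1 := ⟨_, rfl⟩
  obtain ⟨t, ht⟩ : ∃ t : ℤ → ℝ, t = fun n => a (v n) + c n := ⟨_, rfl⟩
  have hsP : ∀ n, s n < P n := by simpa [hs] using hcb
  have hPt : ∀ n, P n < t n := by simpa [ht] using hca
  have hon : ∀ n x (m : ℤ), t n ≤ x + m → x + m ≤ s n + 1 → OnArc (a (v n)) (b (v n)) x := by
    intro n x m h1 h2
    refine ⟨m - c n, ?_, ?_⟩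
    · simp only [ht] at h1
      push_cast
      linarith
    · simp only [hs] at h2
      push_cast
      linarith
  have hoff : ∀ n x, s n < x → x < t n → ¬ OnArc (a (v n)) (b (v n)) x := by
    rintro n x h1 h2 ⟨m, h3, h4⟩
    simp only [hs, ht] at h1 h2
    have h5 : -(c n : ℝ) < m := by linarith
    have h6 : (m : ℝ) < -c n + 1 := by linarith
    have h7 : -c n < m := by exact_mod_cast h5
    have h8 : m < -c n + 1 := by exact_mod_cast h6
    omega
  have hgap : ∀ n x, ¬ OnArc (a (v n)) (b (v n)) x → ∃ m : ℤ, s n < x + m ∧ x + m < t n := by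
    intro n x h
    obtain ⟨m, h1, h2⟩ := exists_lift_of_not_onArc h
    refine ⟨m + c n, ?_, ?_⟩
    · simp only [hs]
      push_cast
      linarith
    · simp only [ht]
      push_cast
      linarith
  have hPs : ∀ n, P n ≤ s (n + 1) := by
    intro n
    by_contra h
    have h1 := hP (show n < n + 1 by omega)
    exact hoff (n + 1) (P n) (not_le.1 h) (h1.trans (hPt _))
      ((hM _ _).2 (hne n 1 (by norm_num) (by norm_num)).symm)
  have htP : ∀ n, t n ≤ P (n + 1) := by
    intro n
    by_contra h
    have h1 := hP (show n < n + 1 by omega)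
    exact hoff n (P (n + 1)) ((hsP n).trans h1) (not_le.1 h)
      ((hM _ _).2 (hne n 1 (by norm_num) (by norm_num)))
  have hPk1 : ∀ n, P (n + 2) ≤ P (n - 1) + 1 := by
    intro n
    have h1 := hPk (n - 1) 1
    push_cast at h1
    rw [← h1]
    exact hP.monotone (by omega)
  have hnext : ∀ n, t (n + 1) ≤ s n + 1 := by
    intro n
    have h1 := htP (n + 1)
    have h2 := hPs (n - 1)
    have h3 := hPk1 n
    rw [show n + 1 + 1 = n + 2 by ring] at h1
    rw [show n - 1 + 1 = n by ring] at h2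
    linarith
  -- A point between `P n` and `P (n + 1)` can only be missed by `v n` and `v (n + 1)`.
  have htwo : ∀ n x, P n ≤ x → x < P (n + 1) → ∀ j, ¬ OnArc (a (v j)) (b (v j)) x →
      v j = v n ∨ v j = v (n + 1) := by
    intro n x h1 h2 j hj
    obtain ⟨m, h3, h4⟩ := hgap j x hj
    have h5 := hPs (j - 1)
    rw [show j - 1 + 1 = j by ring] at h5
    have h6 := htP j
    have h7 : P (j - 1) < P (n + 1 + m * k) := by rw [hPk]; linarith
    have h8 : P (n + m * k) < P (j + 1) := by rw [hPk]; linarith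
    have h9 := hP.lt_iff_lt.1 h7
    have h10 := hP.lt_iff_lt.1 h8
    rw [hv, hv]
    have : j = n + m * k ∨ j = n + 1 + m * k := by omega
    rcases this with rfl | rfl
    · exact Or.inl ⟨-m, by ring⟩
    · exact Or.inr ⟨-m, by ring⟩
  have hover : ∀ n, s (n + 1) < t n := by
    intro n
    by_contra h
    rw [not_lt] at h
    obtain ⟨j, hj⟩ := hcov (t n)
    have h0 : OnArc (a (v n)) (b (v n)) (t n) :=
      hon n _ 0 (by simp) (by simp [hs, ht]; linarith [hab (v n)])
    have h1 : OnArc (a (v (n + 1))) (b (v (n + 1))) (t n) := by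
      refine hon (n + 1) _ 1 ?_ ?_
      · push_cast
        linarith [hnext n, hsP n, hPt n]
      · push_cast
        linarith
    rcases htwo n (t n) (hPt n).le (h.trans_lt (hsP _)) j hj with h2 | h2
    · exact hj (h2 ▸ h0)
    · exact hj (h2 ▸ h1)
  refine ⟨⟨k, v, s, t, c, hk, hv, fun n => by simp [ht], fun n => by simp [hs], ?_, ?_, hover,
    hnext, ?_, ?_⟩, hvS⟩
  · exact fun n => (hsP n).trans_le (hPs n)
  · exact fun n => (htP n).trans_lt (hPt _)
  · intro x
    obtain ⟨i, hi⟩ := hcov x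
    obtain ⟨m, h1, h2⟩ := hgap i x hi
    have h3 := hPs (i - 1)
    rw [show i - 1 + 1 = i by ring] at h3
    have h4 := htP i
    rcases lt_or_ge (x + m) (P i) with h5 | h5
    · refine ⟨i - 1, fun j hj => htwo (i - 1) (x + m) (h3.trans h1.le) (by simpa using h5) j ?_⟩
      rwa [onArc_add_int_iff]
    · refine ⟨i, fun j hj => htwo i (x + m) h5 (h2.trans_le h4) j ?_⟩
      rwa [onArc_add_int_iff]
  · intro n x h1 h2 j h3 h4
    by_contra h
    rcases htwo n x ((hPs n).trans h1.le) (h2.trans_le (htP n)) j h with h | h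
    · exact h3 h
    · exact h4 h

namespace CyclicGaps

variable {V : Type u} {a b : V → ℝ} (C : CyclicGaps a b)

lemma onArc_iff (n : ℤ) {x : ℝ} :
    OnArc (a (C.v n)) (b (C.v n)) x ↔ ∃ m : ℤ, C.t n ≤ x + m ∧ x + m ≤ C.s n + 1 := by
  rw [C.a_eq, C.b_eq]
  constructor
  · rintro ⟨m, h1, h2⟩
    exact ⟨m + C.c n, by push_cast; linarith, by push_cast; linarith⟩
  · rintro ⟨m, h1, h2⟩
    exact ⟨m - C.c n, by push_cast; linarith, by push_cast; linarith⟩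

lemma not_onArc {n : ℤ} {x : ℝ} (h1 : C.s n < x) (h2 : x < C.t n) :
    ¬ OnArc (a (C.v n)) (b (C.v n)) x := by
  rw [C.onArc_iff]
  rintro ⟨m, h3, h4⟩
  have h5 : (0 : ℝ) < m := by linarith
  have h6 : (m : ℝ) < 1 := by linarith
  have h7 : 0 < m := by exact_mod_cast h5
  have h8 : m < 1 := by exact_mod_cast h6
  omega

lemma v_ne (n : ℤ) : C.v n ≠ C.v (n + 1) := by
  rw [Ne, C.v_eq_iff]
  intro h
  have := Int.le_of_dvd (by linarith) h
  have := C.three_le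
  omega

/-- An arc disjoint from that of `v n` has a lift to the gap of `v n`. -/
lemma exists_lift (n : ℤ) {w : V} (hw : a w ≤ b w)
    (hdisj : ∀ x, OnArc (a w) (b w) x → ¬ OnArc (a (C.v n)) (b (C.v n)) x) :
    ∃ m : ℤ, C.s n < a w + m ∧ b w + m < C.t n := by
  obtain ⟨m, h1, h2⟩ := exists_lift_of_not_onArc (hdisj (a w) ⟨0, by simp, by simpa using hw⟩)
  rw [C.b_eq] at h1
  rw [C.a_eq] at h2
  refine ⟨m + C.c n, by push_cast; linarith, ?_⟩
  by_contra h
  push_cast at h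
  have h3 : C.t n ≤ C.s n + 1 := (C.t_lt n).le.trans (C.next_le n)
  refine hdisj (C.t n) ⟨-(m + C.c n), ?_, ?_⟩ ((C.onArc_iff n).2 ⟨0, by simp, by simpa using h3⟩)
  · push_cast
    linarith
  · push_cast
    linarith

end CyclicGaps

/-! ### Circular-arc graphs that are not Helly contain essential obstacles -/

/-- The pairs of vertices whose arcs together cover the circle. -/
def coveringPairs {V : Type u} (a b : V → ℝ) : Set (V × V) :=
  {e | ∀ x, OnArc (a e.1) (b e.1) x ∨ OnArc (a e.2) (b e.2) x}

/-- If the overlap of the gaps of `v n` and `v (n + 1)` contains a point `g` such that no arc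
blocks the extension of the arcs of `v n` and `v (n + 1)` to `g`, then this extension yields a
model having more covering pairs. -/
lemma CyclicGaps.exists_extension {V : Type u} [Finite V] {G : SimpleGraph V} {a b : V → ℝ}
    (hG : IsClosedModel G a b) (C : CyclicGaps a b)
    (hcl : ∀ i j, C.v i ≠ C.v j → G.Adj (C.v i) (C.v j)) (n : ℤ) {g : ℝ}
    (hsg : C.s (n + 1) < g) (hgt : g < C.t n)
    (hl : ∀ w, w ≠ C.v n → ¬ G.Adj w (C.v n) → ∃ m : ℤ, C.s n < a w + m ∧ b w + m < g)
    (hr : ∀ w, w ≠ C.v (n + 1) → ¬ G.Adj w (C.v (n + 1)) →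
      ∃ m : ℤ, g < a w + m ∧ b w + m < C.t (n + 1)) :
    ∃ a' b', IsClosedModel G a' b' ∧ (coveringPairs a b).ncard < (coveringPairs a' b').ncard := by
  classical
  have hvne := C.v_ne n
  have ha := C.a_eq n
  have hb := C.b_eq (n + 1)
  have hst := C.s_lt n
  have htt := C.t_lt n
  have hnx := C.next_le n
  obtain ⟨a', ha'⟩ : ∃ a', a' = Function.update a (C.v n) (g - C.c n) := ⟨_, rfl⟩
  obtain ⟨b', hb'⟩ : ∃ b', b' = Function.update b (C.v (n + 1)) (g + 1 - C.c (n + 1)) := ⟨_, rfl⟩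
  have hle_a : ∀ u, a' u ≤ a u := by
    intro u
    by_cases h : u = C.v n
    · subst h
      rw [ha', Function.update_self]
      linarith
    · rw [ha', Function.update_of_ne h]
  have hle_b : ∀ u, b u ≤ b' u := by
    intro u
    by_cases h : u = C.v (n + 1)
    · subst h
      rw [hb', Function.update_self]
      linarith
    · rw [hb', Function.update_of_ne h]
  have hsub : ∀ u x, OnArc (a u) (b u) x → OnArc (a' u) (b' u) x := by
    rintro u x ⟨m, h1, h2⟩
    exact ⟨m, (hle_a u).trans h1, h2.trans (hle_b u)⟩
  have hsame : ∀ u, u ≠ C.v n → u ≠ C.v (n + 1) → ∀ x,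
      OnArc (a' u) (b' u) x → OnArc (a u) (b u) x := by
    intro u h1 h2 x h
    rwa [ha', hb', Function.update_of_ne h1, Function.update_of_ne h2] at h
  have hn : ∀ x, OnArc (a' (C.v n)) (b' (C.v n)) x ↔ ∃ m : ℤ, g ≤ x + m ∧ x + m ≤ C.s n + 1 := by
    intro x
    rw [ha', hb', Function.update_self, Function.update_of_ne hvne, C.b_eq]
    constructor
    · rintro ⟨m, h1, h2⟩
      exact ⟨m + C.c n, by push_cast; linarith, by push_cast; linarith⟩
    · rintro ⟨m, h1, h2⟩
      exact ⟨m - C.c n, by push_cast; linarith, by push_cast; linarith⟩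
  have hn1 : ∀ x, OnArc (a' (C.v (n + 1))) (b' (C.v (n + 1))) x ↔
      ∃ m : ℤ, C.t (n + 1) ≤ x + m ∧ x + m ≤ g + 1 := by
    intro x
    rw [ha', hb', Function.update_self, Function.update_of_ne hvne.symm, C.a_eq]
    constructor
    · rintro ⟨m, h1, h2⟩
      exact ⟨m + C.c (n + 1), by push_cast; linarith, by push_cast; linarith⟩
    · rintro ⟨m, h1, h2⟩
      exact ⟨m - C.c (n + 1), by push_cast; linarith, by push_cast; linarith⟩
  -- The extended arcs stay disjoint from the arcs of the nonneighbours.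
  have disj : ∀ w x (lo hi c d : ℝ) (m' : ℤ), lo < a w + m' → b w + m' < hi → hi ≤ c →
      d ≤ lo + 1 → OnArc (a w) (b w) x → ¬ ∃ m : ℤ, c ≤ x + m ∧ x + m ≤ d := by
    rintro w x lo hi c d m' h1 h2 h3 h4 ⟨l, h5, h6⟩ ⟨m, h7, h8⟩
    have h9 : (l : ℝ) + m' < m := by linarith
    have h10 : (m : ℝ) < l + m' + 1 := by linarith
    have h11 : l + m' < m := by exact_mod_cast h9
    have h12 : m < l + m' + 1 := by exact_mod_cast h10
    omega
  have dn : ∀ w x, w ≠ C.v n → ¬ G.Adj w (C.v n) → OnArc (a' w) (b' w) x →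
      ¬ OnArc (a' (C.v n)) (b' (C.v n)) x := by
    intro w x h1 h2 h3
    have h4 : w ≠ C.v (n + 1) := by
      rintro rfl
      exact h2 (hcl _ _ h1)
    obtain ⟨m', h5, h6⟩ := hl w h1 h2
    rw [hn]
    exact disj w x _ _ _ _ m' h5 h6 le_rfl le_rfl (hsame w h1 h4 x h3)
  have dn1 : ∀ w x, w ≠ C.v (n + 1) → ¬ G.Adj w (C.v (n + 1)) → OnArc (a' w) (b' w) x →
      ¬ OnArc (a' (C.v (n + 1))) (b' (C.v (n + 1))) x := by
    intro w x h1 h2 h3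
    have h4 : w ≠ C.v n := by
      rintro rfl
      exact h2 (hcl _ _ h1)
    obtain ⟨m', h5, h6⟩ := hr w h1 h2
    rw [hn1]
    exact disj w x _ _ _ _ m' h5 h6 le_rfl le_rfl (hsame w h4 h1 x h3)
  refine ⟨a', b', ⟨fun u => (hle_a u).trans ((hG.le u).trans (hle_b u)), fun u w huw => ?_⟩, ?_⟩
  · rw [hG.adj_iff u w huw]
    constructor
    · rintro ⟨x, h1, h2⟩
      exact ⟨x, hsub u x h1, hsub w x h2⟩
    · rintro ⟨x, h1, h2⟩
      by_contra hcon
      rw [← hG.adj_iff u w huw] at hcon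
      have hcon' : ¬ G.Adj w u := fun h => hcon h.symm
      by_cases hu : u = C.v n
      · subst hu
        exact dn w x huw.symm hcon' h2 h1
      by_cases hu' : u = C.v (n + 1)
      · subst hu'
        exact dn1 w x huw.symm hcon' h2 h1
      by_cases hw : w = C.v n
      · subst hw
        exact dn u x huw hcon h1 h2
      by_cases hw' : w = C.v (n + 1)
      · subst hw'
        exact dn1 u x huw hcon h1 h2
      exact hcon ((hG.adj_iff u w huw).2 ⟨x, hsame u hu hu' x h1, hsame w hw hw' x h2⟩)
  · refine Set.ncard_lt_ncard ⟨fun e he x => (he x).imp (hsub _ x) (hsub _ x), fun hsup => ?_⟩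
      (Set.toFinite _)
    have hcov : (C.v n, C.v (n + 1)) ∈ coveringPairs a' b' := by
      intro x
      simp only [hn, hn1]
      -- A lift of `x` to the interval `[g, g + 1)`.
      have h1 := Int.floor_le (x - g)
      have h2 := Int.lt_floor_add_one (x - g)
      by_cases h3 : x - ⌊x - g⌋ ≤ C.s n + 1
      · exact Or.inl ⟨-⌊x - g⌋, by push_cast; linarith, by push_cast; linarith⟩
      · exact Or.inr ⟨-⌊x - g⌋, by push_cast; linarith, by push_cast; linarith⟩
    rcases hsup hcov g with h | h
    · exact C.not_onArc (hst.trans hsg) hgt h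
    · exact C.not_onArc hsg (hgt.trans htt) h

/-- Either the arcs of `v n` and `v (n + 1)` can be extended until they cover the circle, or
the arcs blocking the extension are witnesses. -/
lemma CyclicGaps.exists_witness_or_extension {V : Type u} [Finite V] {G : SimpleGraph V}
    {a b : V → ℝ} (hG : IsClosedModel G a b) (C : CyclicGaps a b)
    (hcl : ∀ i j, C.v i ≠ C.v j → G.Adj (C.v i) (C.v j)) (n : ℤ) :
    (∃ W : WitnessEnumeration V, W.IsWitness G (Set.range C.v) (C.v n) (C.v (n + 1))) ∨
    ∃ a' b', IsClosedModel G a' b' ∧ (coveringPairs a b).ncard < (coveringPairs a' b').ncard := by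
  classical
  by_contra hcon
  rw [not_or] at hcon
  obtain ⟨hW, hE⟩ := hcon
  have hvne := C.v_ne n
  have hst := C.s_lt n
  have htt := C.t_lt n
  have hnx := C.next_le n
  have hov := C.overlap n
  have hlift : ∀ (i : ℤ) w, ∃ m : ℤ, w ≠ C.v i → ¬ G.Adj w (C.v i) →
      C.s i < a w + m ∧ b w + m < C.t i := by
    intro i w
    by_cases h : w ≠ C.v i ∧ ¬ G.Adj w (C.v i)
    · obtain ⟨m, hm⟩ := C.exists_lift i (hG.le w)
        fun x h1 h2 => h.2 ((hG.adj_iff _ _ h.1).2 ⟨x, h1, h2⟩)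
      exact ⟨m, fun _ _ => hm⟩
    · exact ⟨0, fun h1 h2 => absurd ⟨h1, h2⟩ h⟩
  choose c hc using hlift
  have on_of : ∀ w x (m : ℤ), a w + m ≤ x → x ≤ b w + m → OnArc (a w) (b w) x := fun w x m h1 h2 =>
    ⟨-m, by push_cast; linarith, by push_cast; linarith⟩
  -- A nonneighbour of a core vertex is not in the core; hence meeting arcs mean adjacency.
  have hcore : ∀ i j w, w ≠ C.v i → ¬ G.Adj w (C.v i) → w ≠ C.v j := by
    rintro i j w h1 h2 rfl
    exact h2 (hcl _ _ h1)
  have adj_other : ∀ i w x, w ≠ C.v i → ¬ G.Adj w (C.v i) → OnArc (a w) (b w) x →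
      C.s (n + 1) < x → x < C.t n → ∀ j, C.v j ≠ C.v n → C.v j ≠ C.v (n + 1) →
      G.Adj w (C.v j) := fun i w x h1 h2 hx h3 h4 j h5 h6 =>
    (hG.adj_iff _ _ (hcore i j w h1 h2)).2 ⟨x, hx, C.other n x h3 h4 j h5 h6⟩
  -- No nonneighbour of `v n` lies within the overlap.
  have hL : ∀ w, w ≠ C.v n → ¬ G.Adj w (C.v n) → a w + c n w ≤ C.s (n + 1) := by
    intro w h1 h2
    by_contra h3
    rw [not_le] at h3
    obtain ⟨-, h4⟩ := hc n w h1 h2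
    have h5 := hG.le w
    refine hW ⟨.single w, ?_⟩
    have h6 : ¬ G.Adj w (C.v (n + 1)) := by
      rw [hG.adj_iff _ _ (hcore n (n + 1) w h1 h2)]
      rintro ⟨x, ⟨m, h7, h8⟩, h9⟩
      refine C.not_onArc (x := x + (m + c n w : ℤ)) ?_ ?_ ((onArc_add_int_iff _).2 h9)
      · push_cast
        linarith
      · push_cast
        linarith
    ext u
    constructor
    · rintro ⟨h7, j, rfl⟩
      rw [SimpleGraph.mem_neighborSet, SimpleGraph.compl_adj] at h7
      by_contra h8
      simp only [Set.mem_insert_iff, Set.mem_singleton_iff, not_or] at h8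
      exact h7.2 (adj_other n w (a w + c n w) h1 h2 (on_of w _ (c n w) le_rfl (by linarith)) h3
        (by linarith) j h8.1 h8.2)
    · rintro (rfl | rfl)
      · exact ⟨(SimpleGraph.compl_adj _ _ _).2 ⟨h1, h2⟩, n, rfl⟩
      · exact ⟨(SimpleGraph.compl_adj _ _ _).2 ⟨hcore n (n + 1) w h1 h2, h6⟩, n + 1, rfl⟩
  have hR : ∀ w, w ≠ C.v (n + 1) → ¬ G.Adj w (C.v (n + 1)) → C.t n ≤ b w + c (n + 1) w := by
    intro w h1 h2
    by_contra h3
    rw [not_le] at h3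
    obtain ⟨h4, -⟩ := hc (n + 1) w h1 h2
    have h5 := hG.le w
    refine hW ⟨.single w, ?_⟩
    have h6 : ¬ G.Adj w (C.v n) := by
      rw [hG.adj_iff _ _ (hcore (n + 1) n w h1 h2)]
      rintro ⟨x, ⟨m, h7, h8⟩, h9⟩
      refine C.not_onArc (x := x + (m + c (n + 1) w : ℤ)) ?_ ?_ ((onArc_add_int_iff _).2 h9)
      · push_cast
        linarith
      · push_cast
        linarith
    ext u
    constructor
    · rintro ⟨h7, j, rfl⟩
      rw [SimpleGraph.mem_neighborSet, SimpleGraph.compl_adj] at h7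
      by_contra h8
      simp only [Set.mem_insert_iff, Set.mem_singleton_iff, not_or] at h8
      exact h7.2 (adj_other (n + 1) w (a w + c (n + 1) w) h1 h2
        (on_of w _ (c (n + 1) w) le_rfl (by linarith)) h4 (by linarith) j h8.1 h8.2)
    · rintro (rfl | rfl)
      · exact ⟨(SimpleGraph.compl_adj _ _ _).2 ⟨hcore (n + 1) n w h1 h2, h6⟩, n, rfl⟩
      · exact ⟨(SimpleGraph.compl_adj _ _ _).2 ⟨h1, h2⟩, n + 1, rfl⟩
  -- Two blocking arcs that meet would be a witness pair.
  have hLR : ∀ w, w ≠ C.v n → ¬ G.Adj w (C.v n) → ∀ z, z ≠ C.v (n + 1) →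
      ¬ G.Adj z (C.v (n + 1)) → b w + c n w < a z + c (n + 1) z := by
    intro w hw1 hw2 z hz1 hz2
    by_contra hlt
    rw [not_lt] at hlt
    have hw3 := hL w hw1 hw2
    have hz3 := hR z hz1 hz2
    obtain ⟨hw4, hw5⟩ := hc n w hw1 hw2
    obtain ⟨hz4, hz5⟩ := hc (n + 1) z hz1 hz2
    have hw6 : G.Adj w (C.v (n + 1)) := by
      rw [hG.adj_iff _ _ (hcore n (n + 1) w hw1 hw2)]
      exact ⟨C.s (n + 1), on_of w _ _ hw3 (by linarith), (C.onArc_iff _).2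
        ⟨1, by push_cast; linarith, by push_cast; linarith⟩⟩
    have hz6 : G.Adj z (C.v n) := by
      rw [hG.adj_iff _ _ (hcore (n + 1) n z hz1 hz2)]
      exact ⟨C.t n, on_of z _ _ (by linarith) hz3, (C.onArc_iff _).2
        ⟨0, by simp, by simp; linarith⟩⟩
    have hx1 : OnArc (a w) (b w) (a z + c (n + 1) z) := on_of w _ (c n w) (by linarith) hlt
    have hx2 : OnArc (a z) (b z) (a z + c (n + 1) z) :=
      on_of z _ (c (n + 1) z) le_rfl (by linarith)
    have hwz : w ≠ z := by
      rintro rfl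
      exact hz2 hw6
    refine hW ⟨.pair w z, ?_, ?_, (hG.adj_iff _ _ hwz).2 ⟨_, hx1, hx2⟩⟩
    · ext u
      constructor
      · rintro ⟨h7, j, rfl⟩
        rw [SimpleGraph.mem_neighborSet, SimpleGraph.compl_adj] at h7
        by_contra h8
        rw [Set.mem_singleton_iff] at h8
        by_cases h9 : C.v j = C.v (n + 1)
        · exact h7.2 (h9 ▸ hw6)
        · exact h7.2 (adj_other n w _ hw1 hw2 hx1 hz4 (by linarith) j h8 h9)
      · rintro rfl
        exact ⟨(SimpleGraph.compl_adj _ _ _).2 ⟨hw1, hw2⟩, n, rfl⟩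
    · ext u
      constructor
      · rintro ⟨h7, j, rfl⟩
        rw [SimpleGraph.mem_neighborSet, SimpleGraph.compl_adj] at h7
        by_contra h8
        rw [Set.mem_singleton_iff] at h8
        by_cases h9 : C.v j = C.v n
        · exact h7.2 (h9 ▸ hz6)
        · exact h7.2 (adj_other (n + 1) z _ hz1 hz2 hx2 hz4 (by linarith) j h9 h8)
      · rintro rfl
        exact ⟨(SimpleGraph.compl_adj _ _ _).2 ⟨hz1, hz2⟩, n + 1, rfl⟩
  -- Otherwise some point separates the arcs blocking from the left from those blocking from the
  -- right.
  let FL : Set V := {w | w ≠ C.v n ∧ ¬ G.Adj w (C.v n)}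
  let FR : Set V := {w | w ≠ C.v (n + 1) ∧ ¬ G.Adj w (C.v (n + 1))}
  obtain ⟨g, hg1, hg2⟩ := Order.exists_between_finsets
    (insert (C.s (n + 1)) (FL.toFinite.toFinset.image fun w => b w + c n w))
    (insert (C.t n) (FR.toFinite.toFinset.image fun w => a w + c (n + 1) w)) (by
      simp only [Finset.mem_insert, Finset.mem_image, Set.Finite.mem_toFinset]
      rintro x (rfl | ⟨w, hw, rfl⟩) y (rfl | ⟨z, hz, rfl⟩)
      · exact hov
      · exact (hc _ z hz.1 hz.2).1
      · exact (hc _ w hw.1 hw.2).2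
      · exact hLR w hw.1 hw.2 z hz.1 hz.2)
  refine hE (C.exists_extension hG hcl n (hg1 _ (Finset.mem_insert_self _ _))
    (hg2 _ (Finset.mem_insert_self _ _)) (fun w h1 h2 => ⟨c n w, (hc n w h1 h2).1, hg1 _ ?_⟩)
    (fun w h1 h2 => ⟨c (n + 1) w, hg2 _ ?_, (hc (n + 1) w h1 h2).2⟩))
  · exact Finset.mem_insert_of_mem (Finset.mem_image.2
      ⟨w, (Set.Finite.mem_toFinset _).2 ⟨h1, h2⟩, rfl⟩)
  · exact Finset.mem_insert_of_mem (Finset.mem_image.2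
      ⟨w, (Set.Finite.mem_toFinset _).2 ⟨h1, h2⟩, rfl⟩)

/-- In a closed model with the largest number of covering pairs, every edge of a minimal clique
without common point has witnesses. -/
theorem IsCircularArcGraph.exists_isEssential {V : Type u} [Finite V] {G : SimpleGraph V}
    (h : IsCircularArcGraph G) (hG : ¬ IsHellyCircularArcGraph G) :
    ∃ Q : ObstacleEnumeration G, Q.IsEssential := by
  obtain ⟨a₀, b₀, h₀⟩ := h.exists_isClosedModel
  let F : Set ℕ := {m | ∃ a b, IsClosedModel G a b ∧ (coveringPairs a b).ncard = m}
  have hbdd : BddAbove F := by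
    refine ⟨(Set.univ : Set (V × V)).ncard, ?_⟩
    rintro _ ⟨a, b, -, rfl⟩
    exact Set.ncard_le_ncard (Set.subset_univ _) (Set.toFinite _)
  obtain ⟨a, b, hab, hF⟩ := Nat.sSup_mem (s := F) ⟨_, a₀, b₀, h₀, rfl⟩ hbdd
  have hmax : ¬ ∃ a' b', IsClosedModel G a' b' ∧
      (coveringPairs a b).ncard < (coveringPairs a' b').ncard := by
    rintro ⟨a', b', h1, h2⟩
    have := le_csSup hbdd (show (coveringPairs a' b').ncard ∈ F from ⟨a', b', h1, rfl⟩)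
    omega
  obtain ⟨S, hpair, hno⟩ := hab.exists_of_not_isHelly hG
  obtain ⟨C, hCS⟩ := exists_cyclicGaps hab.le S hpair hno
  have hcl : ∀ i j, C.v i ≠ C.v j → G.Adj (C.v i) (C.v j) := fun i j hij =>
    (hab.adj_iff _ _ hij).2 (hpair _ (hCS i) _ (hCS j))
  have hcast : ∀ n : ℤ, C.v ((n : ZMod C.k).cast : ℤ) = C.v n := by
    intro n
    rw [C.v_eq_iff, ← ZMod.intCast_eq_intCast_iff_dvd_sub, ZMod.intCast_zmod_cast]
  have hrange : Set.range (fun i : ZMod C.k => C.v (i.cast : ℤ)) = Set.range C.v := by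
    ext u
    constructor
    · rintro ⟨i, rfl⟩
      exact ⟨_, rfl⟩
    · rintro ⟨n, rfl⟩
      exact ⟨n, hcast n⟩
  have hsucc : ∀ i : ZMod C.k, C.v ((i + 1 : ZMod C.k).cast : ℤ) = C.v ((i.cast : ℤ) + 1) := by
    intro i
    rw [← hcast ((i.cast : ℤ) + 1)]
    push_cast
    rfl
  refine exists_isEssential_of_witnesses (fun u => OnArc (a u) (b u)) hab.adj_iff C.three_le
    (fun i => C.v (i.cast : ℤ)) ?_ ?_ ?_ ?_
  · intro i j hij
    have := (C.v_eq_iff _ _).1 hij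
    rwa [← ZMod.intCast_eq_intCast_iff_dvd_sub, ZMod.intCast_zmod_cast,
      ZMod.intCast_zmod_cast] at this
  · rintro _ ⟨i, rfl⟩ _ ⟨j, rfl⟩ hij
    exact hcl _ _ hij
  · intro i
    rw [hrange, hsucc]
    exact (C.exists_witness_or_extension hab hcl _).resolve_right hmax
  · intro x
    obtain ⟨n, hn⟩ := C.two x
    refine ⟨n, fun j hj => ?_⟩
    have key : ∀ m : ℤ, C.v (j.cast : ℤ) = C.v m → j = m := by
      intro m hm
      rw [C.v_eq_iff, ← ZMod.intCast_eq_intCast_iff_dvd_sub, ZMod.intCast_zmod_cast] at hm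
      exact hm
    refine (hn _ hj).imp (key n) fun h => ?_
    have := key _ h
    push_cast at this
    exact this

/-! ### Discrete models -/

/-- The circle is divided into `6 * k` cells, which are numbered by the integers modulo `6 * k`.
This is the set of the numbers of the cells from `6 * i + L` to `6 * i + R`. -/
def cellArc {k : ℕ} (i : ZMod k) (L R : ℤ) : Set ℤ :=
  {m | ∃ n : ℤ, (n : ZMod k) = i ∧ L ≤ m - 6 * n ∧ m - 6 * n ≤ R}

lemma ZMod.exists_intCast_eq {k : ℕ} (i : ZMod k) : ∃ n : ℤ, (n : ZMod k) = i :=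
  ⟨i.cast, ZMod.intCast_zmod_cast i⟩

lemma ZMod.exists_eq_add_mul {k : ℕ} {n n' : ℤ} (h : (n : ZMod k) = n') :
    ∃ q : ℤ, n' = n + k * q := by
  obtain ⟨q, hq⟩ := (ZMod.intCast_eq_intCast_iff_dvd_sub _ _ _).1 h
  exact ⟨q, by linarith⟩

lemma add_mem_cellArc {k : ℕ} {i : ZMod k} {L R m : ℤ} (h : m ∈ cellArc i L R) (q : ℤ) :
    m + 6 * k * q ∈ cellArc i L R := by
  obtain ⟨n, hn, h1, h2⟩ := h
  refine ⟨n + k * q, by simp [hn], ?_, ?_⟩ <;> linarith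

/-- The union of the cells of a discrete arc, as a subset of the circle. -/
def cellUnion {k : ℕ} (i : ZMod k) (L R : ℤ) : Set UnitAddCircle :=
  (fun x : ℝ => (x : UnitAddCircle)) '' {x | ⌊6 * k * x⌋ ∈ cellArc i L R}

lemma coe_mem_cellUnion {k : ℕ} {i : ZMod k} {L R : ℤ} {x : ℝ} :
    (x : UnitAddCircle) ∈ cellUnion i L R ↔ ⌊6 * k * x⌋ ∈ cellArc i L R := by
  constructor
  · rintro ⟨y, hy, hyx⟩
    obtain ⟨q, rfl⟩ := UnitAddCircle.coe_eq_coe_iff.1 hyx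
    have := add_mem_cellArc (Set.mem_ofPred.1 hy) (-q)
    rwa [← Int.floor_add_intCast, show (6 * k * (x + q) + ((6 * k * -q : ℤ) : ℝ)) = 6 * k * x by
      push_cast; ring] at this
  · exact fun h => ⟨x, h, rfl⟩

lemma isArc_cellUnion {k : ℕ} (hk : 0 < k) (i : ZMod k) {L R : ℤ} (h : L ≤ R) :
    IsArc (cellUnion i L R) := by
  obtain ⟨n, hn⟩ := ZMod.exists_intCast_eq i
  have hk' : (0 : ℝ) < 6 * k := by positivity
  refine ⟨{x | 6 * n + L ≤ ⌊6 * k * x⌋ ∧ ⌊6 * k * x⌋ ≤ 6 * n + R}, ⟨(6 * n + L : ℤ) / (6 * k), ?_⟩,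
    ⟨?_⟩, ?_⟩
  · rw [Set.mem_ofPred, mul_div_cancel₀ _ hk'.ne', Int.floor_intCast]
    exact ⟨le_rfl, by linarith⟩
  · rintro x ⟨hx, -⟩ y ⟨-, hy⟩ z ⟨hxz, hzy⟩
    exact ⟨hx.trans (Int.floor_mono (by gcongr)), (Int.floor_mono (by gcongr)).trans hy⟩
  · ext θ
    constructor
    · rintro ⟨x, ⟨n', hn', h1, h2⟩, rfl⟩
      obtain ⟨q, rfl⟩ := ZMod.exists_eq_add_mul (hn.trans hn'.symm)
      refine ⟨x + (-q : ℤ), ?_, UnitAddCircle.coe_add_int _ _⟩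
      have : ⌊6 * k * (x + (-q : ℤ))⌋ = ⌊6 * k * x⌋ - 6 * k * q := by
        rw [show (6 * k * (x + (-q : ℤ)) : ℝ) = 6 * k * x + ((-(6 * k * q) : ℤ) : ℝ) by
          push_cast; ring, Int.floor_add_intCast]
        ring
      rw [Set.mem_ofPred, this]
      constructor <;> linarith
    · rintro ⟨x, ⟨h1, h2⟩, rfl⟩
      exact ⟨x, ⟨n, hn, by linarith, by linarith⟩, rfl⟩

/-- A discrete model yields a circular-arc model; the latter is Helly if every clique has a common
cell. -/
lemma exists_model_of_cells {V : Type u} {G : SimpleGraph V} {k : ℕ} (hk : 0 < k) (i : V → ZMod k)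
    (L R : V → ℤ) (hLR : ∀ v, L v ≤ R v)
    (hadj : ∀ u v, u ≠ v → (G.Adj u v ↔
      ∃ m, m ∈ cellArc (i u) (L u) (R u) ∧ m ∈ cellArc (i v) (L v) (R v))) :
    ∃ A, IsCircularArcModel G A ∧
      ((∀ K : Set V, G.IsClique K → ∃ m, ∀ v ∈ K, m ∈ cellArc (i v) (L v) (R v)) →
        IsHellyFamily A) := by
  have hk' : (0 : ℝ) < 6 * k := by positivity
  have hfl : ∀ m : ℤ, ⌊6 * k * ((m : ℝ) / (6 * k))⌋ = m := by
    intro m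
    rw [mul_div_cancel₀ _ hk'.ne', Int.floor_intCast]
  have hmodel : IsCircularArcModel G fun v => cellUnion (i v) (L v) (R v) := by
    refine ⟨fun v => isArc_cellUnion hk _ (hLR v), fun u v huv => ?_⟩
    rw [hadj u v huv]
    constructor
    · rintro ⟨m, h1, h2⟩
      exact ⟨((m / (6 * k) : ℝ) : UnitAddCircle), coe_mem_cellUnion.2 (by rwa [hfl]),
        coe_mem_cellUnion.2 (by rwa [hfl])⟩
    · rintro ⟨θ, h1, h2⟩
      obtain ⟨x, rfl⟩ := QuotientAddGroup.mk_surjective θ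
      exact ⟨_, coe_mem_cellUnion.1 h1, coe_mem_cellUnion.1 h2⟩
  refine ⟨_, hmodel, fun hK S _ hS => ?_⟩
  obtain ⟨m, hm⟩ := hK S fun u hu v hv huv => (hmodel.2 u v huv).2 (hS u hu v hv)
  exact ⟨((m / (6 * k) : ℝ) : UnitAddCircle), Set.mem_iInter₂.2 fun v hv =>
    coe_mem_cellUnion.2 (by rw [hfl]; exact hm v hv)⟩

/-- A discrete arc described by its complement. -/
lemma mem_cellArc_compl_iff {k : ℕ} (hk : 0 < k) {j : ZMod k} {lo hi m : ℤ} :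
    m ∈ cellArc j (hi + 1) (6 * k + lo - 1) ↔
      ∀ n : ℤ, (n : ZMod k) = j → lo ≤ m - 6 * n → hi < m - 6 * n := by
  have hk' : (0 : ℤ) < k := by exact_mod_cast hk
  constructor
  · rintro ⟨n', hn', h1, h2⟩ n hn h3
    obtain ⟨q, rfl⟩ := ZMod.exists_eq_add_mul (hn'.trans hn.symm)
    have : q ≤ 0 := by
      by_contra hq
      have : (k : ℤ) * 1 ≤ k * q := by gcongr; omega
      linarith
    have : (k : ℤ) * q ≤ 0 := mul_nonpos_of_nonneg_of_nonpos hk'.le this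
    linarith
  · intro h
    obtain ⟨n₀, hn₀⟩ := ZMod.exists_intCast_eq j
    have h1 := Int.emod_add_mul_ediv (m - 6 * n₀ - lo) (6 * k)
    have h2 := Int.emod_nonneg (m - 6 * n₀ - lo) (b := 6 * k) (by omega)
    have h3 := Int.emod_lt_of_pos (m - 6 * n₀ - lo) (b := 6 * k) (by omega)
    have h4 : ((n₀ + k * ((m - 6 * n₀ - lo) / (6 * k)) : ℤ) : ZMod k) = j := by simp [hn₀]
    have h5 := h _ h4 (by linarith)
    exact ⟨_, h4, by linarith, by linarith⟩

/-! ### Adjacent witnesses of an essential obstacle enumeration -/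

namespace ObstacleEnumeration

variable {V : Type u} {G : SimpleGraph V} (Q : ObstacleEnumeration G)

/-- `y` is a witness whose only non-neighbour in the core is `v i`. -/
def IsSideWitness (y : V) (i : ZMod Q.k) : Prop :=
  y ∈ Q.witnesses ∧ Gᶜ.neighborSet y ∩ Q.core = {Q.v i}

variable {Q}

lemma mem_witnesses {i : ZMod Q.k} {y : V} (h : y ∈ (Q.W i).verts) : y ∈ Q.witnesses :=
  Set.mem_iUnion_of_mem i h

lemma IsSideWitness.of_left {i : ZMod Q.k} {y z : V} (h : Q.W i = .pair y z) :
    Q.IsSideWitness y i :=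
  ⟨mem_witnesses (i := i) (by rw [h]; exact Or.inl rfl), Q.conbr_left h⟩

lemma IsSideWitness.index_unique {y : V} {i j : ZMod Q.k} (h : Q.IsSideWitness y i)
    (h' : Q.IsSideWitness y j) : i = j :=
  Q.injective (by simpa using h.2.symm.trans h'.2)

lemma IsSideWitness.not_single {y : V} {i j : ZMod Q.k} (h : Q.IsSideWitness y i) :
    Q.W j ≠ .single y := fun h' =>
  Q.v_pair_ne _ _ ((Q.conbr_single h').symm.trans h.2)

lemma IsSideWitness.left_of_mem {y : V} {i : ZMod Q.k} (h : Q.IsSideWitness y i)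
    (hy : y ∈ (Q.W i).verts) : ∃ z, Q.W i = .pair y z := by
  rcases Q.mem_verts_cases h.2 hy with ⟨-, h⟩ | ⟨h, -⟩
  · exact h
  · exact absurd h (Q.add_one_ne i)

lemma IsSideWitness.right_of_mem {y : V} {i : ZMod Q.k} (h : Q.IsSideWitness y i)
    (hy : y ∈ (Q.W (i - 1)).verts) : ∃ z, Q.W (i - 1) = .pair z y := by
  rcases Q.mem_verts_cases h.2 hy with ⟨h, -⟩ | ⟨-, h⟩
  · exact absurd (by rw [sub_add_cancel, h]) (Q.add_one_ne (i - 1))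
  · exact h

lemma IsSideWitness.mem_or_mem {y : V} {i : ZMod Q.k} (h : Q.IsSideWitness y i) :
    y ∈ (Q.W (i - 1)).verts ∨ y ∈ (Q.W i).verts := by
  obtain ⟨j, hj⟩ := Set.mem_iUnion.1 h.1
  rcases Q.mem_verts_cases h.2 hj with ⟨rfl, -⟩ | ⟨rfl, -⟩
  · exact Or.inr hj
  · exact Or.inl (by rwa [add_sub_cancel_right])

/-- There are at most two witnesses whose only non-neighbour in the core is `v i`: the second one at
`i - 1` and the first one at `i`. -/
lemma IsSideWitness.eq_or_mem {y y' : V} {i : ZMod Q.k} (h : Q.IsSideWitness y i)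
    (h' : Q.IsSideWitness y' i) : y = y' ∨
      (y ∈ (Q.W (i - 1)).verts ∧ y' ∉ (Q.W (i - 1)).verts ∧ y ∉ (Q.W i).verts ∧
        y' ∈ (Q.W i).verts) ∨
      (y' ∈ (Q.W (i - 1)).verts ∧ y ∉ (Q.W (i - 1)).verts ∧ y' ∉ (Q.W i).verts ∧
        y ∈ (Q.W i).verts) := by
  by_cases hyy : y = y'
  · exact Or.inl hyy
  have h1 : y ∈ (Q.W (i - 1)).verts → y' ∉ (Q.W (i - 1)).verts := by
    intro hy hy'
    obtain ⟨z, hz⟩ := h.right_of_mem hy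
    obtain ⟨z', hz'⟩ := h'.right_of_mem hy'
    rw [hz] at hz'
    injection hz' with _ e
    exact hyy e
  have h2 : y ∈ (Q.W i).verts → y' ∉ (Q.W i).verts := by
    intro hy hy'
    obtain ⟨z, hz⟩ := h.left_of_mem hy
    obtain ⟨z', hz'⟩ := h'.left_of_mem hy'
    rw [hz] at hz'
    injection hz' with e _
    exact hyy e
  have h3 := h.mem_or_mem
  have h4 := h'.mem_or_mem
  tauto

lemma cases_of_mem_witnesses {y : V} (h : y ∈ Q.witnesses) :
    (∃ i, Q.W i = .single y) ∨ ∃ i, Q.IsSideWitness y i :=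
  (Q.witness_cases h).imp_right fun ⟨i, hi⟩ => ⟨i, h, hi⟩

lemma IsEssential.side_side (hE : Q.IsEssential) {y y' : V} {i j : ZMod Q.k}
    (h : Q.IsSideWitness y i) (h' : Q.IsSideWitness y' j) (hij : i ≠ j) (hadj : G.Adj y y') :
    (j = i + 1 ∧ Q.W i = .pair y y') ∨ (i = j + 1 ∧ Q.W j = .pair y' y) := by
  rcases hE y h.1 y' h'.1 hadj with hs | hs | ⟨l, hl, hl'⟩
  · rw [h.2, h'.2] at hs
    exact absurd (Q.injective (by simpa using hs)) hij
  · rw [h.2, h'.2] at hs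
    exact absurd (Q.injective (by simpa using hs)) hij.symm
  · rcases Q.mem_verts_cases h.2 hl with ⟨rfl, z, hz⟩ | ⟨rfl, z, hz⟩ <;>
      rcases Q.mem_verts_cases h'.2 hl' with ⟨rfl, z', hz'⟩ | ⟨rfl, z', hz'⟩
    · exact absurd rfl hij
    · rw [hz] at hz'
      injection hz' with _ e
      exact Or.inl ⟨rfl, by rw [hz, e]⟩
    · rw [hz] at hz'
      injection hz' with e _
      exact Or.inr ⟨rfl, by rw [hz, e]⟩
    · exact absurd rfl hij

lemma IsEssential.single_single (hE : Q.IsEssential) {w w' : V} {i j : ZMod Q.k}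
    (h : Q.W i = .single w) (h' : Q.W j = .single w') : ¬ G.Adj w w' := by
  intro hadj
  have hij : i ≠ j := by
    rintro rfl
    rw [h] at h'
    injection h' with e
    exact hadj.ne e
  have key : ∀ {a b : ZMod Q.k}, ({Q.v a, Q.v (a + 1)} : Set V) ⊆ {Q.v b, Q.v (b + 1)} →
      a = b := by
    intro a b hs
    have h1 : Q.v a = Q.v b ∨ Q.v a = Q.v (b + 1) := hs (Or.inl rfl)
    have h2 : Q.v (a + 1) = Q.v b ∨ Q.v (a + 1) = Q.v (b + 1) := hs (Or.inr rfl)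
    simp only [Q.injective.eq_iff] at h1 h2
    rcases h1 with h1 | rfl
    · exact h1
    · rcases h2 with h2 | h2
      · exact absurd h2 (Q.add_two_ne b)
      · exact absurd h2 (Q.add_one_ne (b + 1))
  rcases hE w (mem_witnesses (i := i) (by rw [h]; rfl)) w'
    (mem_witnesses (i := j) (by rw [h']; rfl)) hadj with hs | hs | ⟨l, hl, hl'⟩
  · rw [Q.conbr_single h, Q.conbr_single h'] at hs
    exact hij (key hs)
  · rw [Q.conbr_single h, Q.conbr_single h'] at hs
    exact hij (key hs).symm
  · exact hij ((Q.eq_single_of_mem_verts (Q.conbr_single h) hl).1.symm.trans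
      (Q.eq_single_of_mem_verts (Q.conbr_single h') hl').1)

lemma IsEssential.single_side (hE : Q.IsEssential) {w y : V} {i j : ZMod Q.k}
    (h : Q.W i = .single w) (h' : Q.IsSideWitness y j) (hadj : G.Adj w y) :
    j = i ∨ j = i + 1 := by
  rcases hE w (mem_witnesses (i := i) (by rw [h]; rfl)) y h'.1 hadj with hs | hs | ⟨l, hl, hl'⟩
  · rw [Q.conbr_single h, h'.2] at hs
    have h1 : Q.v i = Q.v j := hs (Or.inl rfl)
    have h2 : Q.v (i + 1) = Q.v j := hs (Or.inr rfl)
    exact absurd (Q.injective (h2.trans h1.symm)) (Q.add_one_ne i)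
  · rw [Q.conbr_single h, h'.2] at hs
    have h1 : Q.v j = Q.v i ∨ Q.v j = Q.v (i + 1) := hs rfl
    exact h1.imp (fun e => Q.injective e) (fun e => Q.injective e)
  · obtain ⟨-, hw⟩ := Q.eq_single_of_mem_verts (Q.conbr_single h) hl
    rw [hw] at hl'
    exact absurd (hl' : y = w) hadj.ne'

/-- Three pairwise adjacent witnesses do not include a single witness. -/
lemma IsEssential.not_triangle_single (hE : Q.IsEssential) {w y z : V} {i : ZMod Q.k}
    (hw : Q.W i = .single w) (hy : y ∈ Q.witnesses) (hz : z ∈ Q.witnesses) (hwy : G.Adj w y)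
    (hwz : G.Adj w z) : ¬ G.Adj y z := by
  intro hyz
  rcases cases_of_mem_witnesses hy with ⟨j, hj⟩ | ⟨j, hj⟩
  · exact hE.single_single hw hj hwy
  rcases cases_of_mem_witnesses hz with ⟨l, hl⟩ | ⟨l, hl⟩
  · exact hE.single_single hw hl hwz
  have hnot : ∀ {x : V} {m : ZMod Q.k}, Q.IsSideWitness x m → x ∉ (Q.W i).verts := by
    intro x m hx hmem
    rw [hw] at hmem
    obtain rfl : x = w := hmem
    exact hx.not_single hw
  by_cases hjl : j = l
  · subst hjl
    rcases hE.single_side hw hj hwy with rfl | rfl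
    · rcases hj.eq_or_mem hl with h | ⟨-, -, -, h⟩ | ⟨-, -, -, h⟩
      · exact hyz.ne h
      · exact hnot hl h
      · exact hnot hj h
    · rcases hj.eq_or_mem hl with h | ⟨h, -⟩ | ⟨h, -⟩
      · exact hyz.ne h
      · rw [add_sub_cancel_right] at h
        exact hnot hj h
      · rw [add_sub_cancel_right] at h
        exact hnot hl h
  · have h1 := hE.single_side hw hj hwy
    have h2 := hE.single_side hw hl hwz
    have e1 := Q.add_two_ne i
    rcases hE.side_side hj hl hjl hyz with ⟨h3, h4⟩ | ⟨h3, h4⟩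
    · rcases h1 with rfl | rfl
      · rw [hw] at h4
        cases h4
      · rcases h2 with rfl | rfl
        · exact e1 h3.symm
        · exact hjl rfl
    · rcases h2 with rfl | rfl
      · rw [hw] at h4
        cases h4
      · rcases h1 with rfl | rfl
        · exact e1 h3.symm
        · exact hjl rfl

/-- Three pairwise adjacent witnesses miss three different core vertices. -/
lemma IsEssential.not_triangle_same (hE : Q.IsEssential) {x y z : V} {i j : ZMod Q.k}
    (hx : Q.IsSideWitness x i) (hy : Q.IsSideWitness y i) (hz : Q.IsSideWitness z j)
    (hxy : G.Adj x y) (hxz : G.Adj x z) : ¬ G.Adj y z := by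
  intro hyz
  have hij : i ≠ j := by
    rintro rfl
    have h1 := hx.eq_or_mem hy
    have h2 := hx.eq_or_mem hz
    have h3 := hy.eq_or_mem hz
    have := hxy.ne
    have := hxz.ne
    have := hyz.ne
    tauto
  rcases hE.side_side hx hz hij hxz with ⟨h1, h2⟩ | ⟨h1, h2⟩ <;>
    rcases hE.side_side hy hz hij hyz with ⟨h3, h4⟩ | ⟨h3, h4⟩
  · rw [h2] at h4
    injection h4 with e _
    exact hxy.ne e
  · rw [h1] at h3
    exact Q.add_two_ne i h3.symm
  · rw [h3] at h1
    exact Q.add_two_ne i h1.symm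
  · rw [h2] at h4
    injection h4 with _ e
    exact hxy.ne e

/-- If there are three pairwise adjacent witnesses then the core is a triangle, and the graph is the
octahedron. -/
lemma IsEssential.triangle (hE : Q.IsEssential) {x y z : V} (hx : x ∈ Q.witnesses)
    (hy : y ∈ Q.witnesses) (hz : z ∈ Q.witnesses) (hxy : G.Adj x y) (hxz : G.Adj x z)
    (hyz : G.Adj y z) : Q.k = 3 ∧ ∃ f : ZMod Q.k → V,
      (∀ i, Q.W i = .pair (f i) (f (i + 1))) ∧ ∀ i, f i = x ∨ f i = y ∨ f i = z := by
  rcases cases_of_mem_witnesses hx with ⟨a, ha⟩ | ⟨a, ha⟩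
  · exact absurd hyz (hE.not_triangle_single ha hy hz hxy hxz)
  rcases cases_of_mem_witnesses hy with ⟨b, hb⟩ | ⟨b, hb⟩
  · exact absurd hxz (hE.not_triangle_single hb hx hz hxy.symm hyz)
  rcases cases_of_mem_witnesses hz with ⟨c, hc⟩ | ⟨c, hc⟩
  · exact absurd hxy (hE.not_triangle_single hc hx hy hxz.symm hyz.symm)
  have hab : a ≠ b := by
    rintro rfl
    exact hE.not_triangle_same ha hb hc hxy hxz hyz
  have hac : a ≠ c := by
    rintro rfl
    exact hE.not_triangle_same ha hc hb hxz hxy hyz.symm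
  have hbc : b ≠ c := by
    rintro rfl
    exact hE.not_triangle_same hb hc ha hyz hxy.symm hxz.symm
  have hk3 : ∀ n : ℕ, 3 ≤ n → (3 : ZMod n) = 0 → n = 3 := by
    intro n hn h
    have h3 : ((3 : ℕ) : ZMod n) = 0 := by exact_mod_cast h
    rw [ZMod.natCast_eq_zero_iff] at h3
    have := Nat.le_of_dvd (by norm_num) h3
    omega
  have hall : ∀ n : ℕ, n = 3 → ∀ i j : ZMod n, j = i ∨ j = i + 1 ∨ j = i + 1 + 1 := by
    rintro n rfl
    decide
  -- The common end of the argument, for the two cyclic orders of the triangle.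
  have fin : ∀ {x y z : V} {a : ZMod Q.k}, Q.W a = .pair x y → Q.W (a + 1) = .pair y z →
      Q.W (a + 1 + 1) = .pair z x → a + 1 + 1 + 1 = a → Q.k = 3 ∧ ∃ f : ZMod Q.k → V,
      (∀ i, Q.W i = .pair (f i) (f (i + 1))) ∧ ∀ i, f i = x ∨ f i = y ∨ f i = z := by
    intro x y z a h1 h2 h3 h4
    have hk : Q.k = 3 := hk3 _ Q.three_le (by linear_combination h4)
    have hf : ∀ i, ∃ u u', Q.W i = .pair u u' := by
      intro i
      rcases hall _ hk a i with rfl | rfl | rfl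
      · exact ⟨_, _, h1⟩
      · exact ⟨_, _, h2⟩
      · exact ⟨_, _, h3⟩
    choose f f' hf using hf
    have e1 : f a = x := by have := (hf a).symm.trans h1; injection this
    have e2 : f (a + 1) = y := by have := (hf _).symm.trans h2; injection this
    have e3 : f (a + 1 + 1) = z := by have := (hf _).symm.trans h3; injection this
    refine ⟨hk, f, fun i => ?_, fun i => ?_⟩
    · rcases hall _ hk a i with rfl | rfl | rfl
      · rw [h1, e1, e2]
      · rw [h2, e2, e3]
      · rw [h3, e3, h4, e1]
    · rcases hall _ hk a i with rfl | rfl | rfl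
      · exact Or.inl e1
      · exact Or.inr (Or.inl e2)
      · exact Or.inr (Or.inr e3)
  rcases hE.side_side ha hb hab hxy with ⟨h1, h2⟩ | ⟨h1, h2⟩ <;>
    rcases hE.side_side hb hc hbc hyz with ⟨h3, h4⟩ | ⟨h3, h4⟩ <;>
    rcases hE.side_side ha hc hac hxz with ⟨h5, h6⟩ | ⟨h5, h6⟩
  · exact absurd (h1.trans h5.symm) hbc
  · subst h1 h3
    exact fin h2 h4 h6 h5.symm
  · exact absurd (h1.trans h5.symm) hbc
  · exact absurd (add_right_cancel (h1.symm.trans h3)).symm hac.symm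
  · exact absurd (h1.trans h3.symm) hac
  · exact absurd (h1.trans h3.symm) hac
  · subst h3 h5
    obtain ⟨hk, f, hf, hf'⟩ := fin h6 h4 h2 h1.symm
    exact ⟨hk, f, hf, fun i => (hf' i).imp_right Or.symm⟩
  · exact absurd (add_right_cancel (h1.symm.trans h5)) hbc

end ObstacleEnumeration

/-! ### The model of an essential obstacle -/

namespace ObstacleEnumeration

variable {V : Type u} {G : SimpleGraph V} (Q : ObstacleEnumeration G)

open Classical in
/-- The left end, relative to the cell `6 * i`, of the arc of a side witness `y` at `v i`: it
extends to the middle of the preceding overlap if `y` occurs there, it touches that overlap if it has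
to meet a single witness there, and otherwise it reaches the cell `1` precisely if it has to
meet the other side witness at `v i`. -/
noncomputable def leftEnd (y : V) (i : ZMod Q.k) : ℤ :=
  if y ∈ (Q.W (i - 1)).verts then -2
  else if ∃ w, Q.W (i - 1) = .single w ∧ G.Adj w y then -1
  else if ∃ y', Q.IsSideWitness y' i ∧ G.Adj y y' then 1
  else 2

open Classical in
/-- The right end of the arc of a side witness `y` at `v i`; see `leftEnd`. -/
noncomputable def rightEnd (y : V) (i : ZMod Q.k) : ℤ :=
  if y ∈ (Q.W i).verts then 4
  else if ∃ w, Q.W i = .single w ∧ G.Adj w y then 3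
  else if ∃ y', Q.IsSideWitness y' i ∧ G.Adj y y' then 1
  else 0

variable {Q}

lemma leftEnd_cases (y : V) (i : ZMod Q.k) :
    (Q.leftEnd y i = -2 ∧ y ∈ (Q.W (i - 1)).verts) ∨
    (Q.leftEnd y i = -1 ∧ ∃ w, Q.W (i - 1) = .single w ∧ G.Adj w y) ∨
    (Q.leftEnd y i = 1 ∧ y ∉ (Q.W (i - 1)).verts ∧ (¬ ∃ w, Q.W (i - 1) = .single w ∧ G.Adj w y) ∧
      ∃ y', Q.IsSideWitness y' i ∧ G.Adj y y') ∨
    (Q.leftEnd y i = 2 ∧ y ∉ (Q.W (i - 1)).verts ∧ (¬ ∃ w, Q.W (i - 1) = .single w ∧ G.Adj w y) ∧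
      ¬ ∃ y', Q.IsSideWitness y' i ∧ G.Adj y y') := by
  unfold leftEnd
  split_ifs with h1 h2 h3
  · exact Or.inl ⟨rfl, h1⟩
  · exact Or.inr (Or.inl ⟨rfl, h2⟩)
  · exact Or.inr (Or.inr (Or.inl ⟨rfl, h1, h2, h3⟩))
  · exact Or.inr (Or.inr (Or.inr ⟨rfl, h1, h2, h3⟩))

lemma rightEnd_cases (y : V) (i : ZMod Q.k) :
    (Q.rightEnd y i = 4 ∧ y ∈ (Q.W i).verts) ∨
    (Q.rightEnd y i = 3 ∧ ∃ w, Q.W i = .single w ∧ G.Adj w y) ∨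
    (Q.rightEnd y i = 1 ∧ y ∉ (Q.W i).verts ∧ (¬ ∃ w, Q.W i = .single w ∧ G.Adj w y) ∧
      ∃ y', Q.IsSideWitness y' i ∧ G.Adj y y') ∨
    (Q.rightEnd y i = 0 ∧ y ∉ (Q.W i).verts ∧ (¬ ∃ w, Q.W i = .single w ∧ G.Adj w y) ∧
      ¬ ∃ y', Q.IsSideWitness y' i ∧ G.Adj y y') := by
  unfold rightEnd
  split_ifs with h1 h2 h3
  · exact Or.inl ⟨rfl, h1⟩
  · exact Or.inr (Or.inl ⟨rfl, h2⟩)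
  · exact Or.inr (Or.inr (Or.inl ⟨rfl, h1, h2, h3⟩))
  · exact Or.inr (Or.inr (Or.inr ⟨rfl, h1, h2, h3⟩))

lemma leftEnd_of_mem {y : V} {i : ZMod Q.k} (h : y ∈ (Q.W (i - 1)).verts) :
    Q.leftEnd y i = -2 := if_pos h

lemma rightEnd_of_mem {y : V} {i : ZMod Q.k} (h : y ∈ (Q.W i).verts) :
    Q.rightEnd y i = 4 := if_pos h

lemma leftEnd_bounds (y : V) (i : ZMod Q.k) : -2 ≤ Q.leftEnd y i ∧ Q.leftEnd y i ≤ 2 := by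
  rcases leftEnd_cases y i with h | h | h | h <;> omega

lemma rightEnd_bounds (y : V) (i : ZMod Q.k) : 0 ≤ Q.rightEnd y i ∧ Q.rightEnd y i ≤ 4 := by
  rcases rightEnd_cases y i with h | h | h | h <;> omega

lemma IsSideWitness.leftEnd_le_rightEnd {y : V} {i : ZMod Q.k} (h : Q.IsSideWitness y i) :
    Q.leftEnd y i ≤ Q.rightEnd y i := by
  have h1 := leftEnd_bounds y i
  have h2 := rightEnd_bounds y i
  rcases h.mem_or_mem with h | h
  · rw [leftEnd_of_mem h]
    omega
  · rw [rightEnd_of_mem h]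
    omega

lemma mem_of_le_leftEnd {y : V} {i : ZMod Q.k}
    (h1 : Q.leftEnd y i ≤ -2) : y ∈ (Q.W (i - 1)).verts := by
  rcases leftEnd_cases y i with h | h | h | h <;> first | omega | exact h.2

lemma mem_of_le_rightEnd {y : V} {i : ZMod Q.k} (h1 : 4 ≤ Q.rightEnd y i) :
    y ∈ (Q.W i).verts := by
  rcases rightEnd_cases y i with h | h | h | h <;> first | omega | exact h.2

/-- The location of a vertex in the model whose gaps are given by `lo` and `hi`: the cells from
`6 * i + L` to `6 * i + R`.  The complement of the arc of a core vertex `v i` consists of the cells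
from `6 * i + lo i` to `6 * i + hi i`. -/
inductive Located (Q : ObstacleEnumeration G) (lo hi : ZMod Q.k → ℤ) :
    V → ZMod Q.k → ℤ → ℤ → Prop
  | core (j : ZMod Q.k) : Located Q lo hi (Q.v j) j (hi j + 1) (6 * Q.k + lo j - 1)
  | single (w : V) (i : ZMod Q.k) (h : Q.W i = .single w) : Located Q lo hi w i 3 5
  | side (y : V) (i : ZMod Q.k) (h : Q.IsSideWitness y i) :
      Located Q lo hi y i (Q.leftEnd y i) (Q.rightEnd y i)

/-- Bounds for the gaps: each contains the three cells lying in no other gap, and is contained in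
the range of the largest possible gap. -/
structure GapBounds (k : ℕ) (lo hi : ZMod k → ℤ) : Prop where
  three_le : 3 ≤ k
  le_lo : ∀ i, -3 ≤ lo i
  lo_le : ∀ i, lo i ≤ 0
  le_hi : ∀ i, 2 ≤ hi i
  hi_le : ∀ i, hi i ≤ 5

namespace GapBounds

variable {k : ℕ} {lo hi : ZMod k → ℤ}

lemma mem_core (h : GapBounds k lo hi) {n t : ℤ} (ht : 0 ≤ t) (ht' : t ≤ 5) {j : ZMod k}
    (h1 : j ≠ (n : ZMod k))
    (h2 : 3 ≤ t → j ≠ (n : ZMod k) + 1) :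
    6 * n + t ∈ cellArc j (hi j + 1) (6 * k + lo j - 1) := by
  have hk := h.three_le
  rw [mem_cellArc_compl_iff (by omega)]
  rintro n' rfl h3
  by_contra h4
  have h5 := h.le_lo (n' : ZMod k)
  have h6 := h.hi_le (n' : ZMod k)
  by_cases h7 : n' = n
  · exact h1 (by rw [h7])
  · have h8 : n' = n + 1 := by omega
    refine h2 (by omega) ?_
    rw [h8]
    push_cast
    rfl

lemma notMem_core (h : GapBounds k lo hi) {n m : ℤ} {j : ZMod k} (hn : (n : ZMod k) = j)
    (h1 : lo j ≤ m - 6 * n)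
    (h2 : m - 6 * n ≤ hi j) : m ∉ cellArc j (hi j + 1) (6 * k + lo j - 1) := by
  have hk := h.three_le
  rw [mem_cellArc_compl_iff (by omega)]
  intro h'
  exact absurd (h' n hn h1) (by omega)

/-- Any two core arcs meet. -/
lemma exists_mem_core_core (h : GapBounds k lo hi) (i j : ZMod k) :
    ∃ m, m ∈ cellArc i (hi i + 1) (6 * k + lo i - 1) ∧
      m ∈ cellArc j (hi j + 1) (6 * k + lo j - 1) := by
  have hk := h.three_le
  have : NeZero k := ⟨by omega⟩
  obtain ⟨l, hl⟩ : ∃ l, l ∉ ({i, j} : Finset (ZMod k)) := by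
    by_contra hcon
    push Not at hcon
    have h1 : (Finset.univ : Finset (ZMod k)).card ≤ ({i, j} : Finset (ZMod k)).card :=
      Finset.card_le_card fun x _ => hcon x
    rw [Finset.card_univ, ZMod.card] at h1
    have := Finset.card_le_two (a := i) (b := j)
    omega
  simp only [Finset.mem_insert, Finset.mem_singleton, not_or] at hl
  obtain ⟨n, rfl⟩ := ZMod.exists_intCast_eq l
  exact ⟨6 * n + 1, h.mem_core (by norm_num) (by norm_num) (Ne.symm hl.1) (by norm_num),
    h.mem_core (by norm_num) (by norm_num) (Ne.symm hl.2) (by norm_num)⟩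

end GapBounds

/-- The cell `m` lies on the arcs of all the core vertices that are adjacent to both `y`
and `y'`. -/
def IsCommonCell (Q : ObstacleEnumeration G) (lo hi : ZMod Q.k → ℤ) (y y' : V) (m : ℤ) : Prop :=
  ∀ j, G.Adj y (Q.v j) → G.Adj y' (Q.v j) → m ∈ cellArc j (hi j + 1) (6 * Q.k + lo j - 1)

variable {lo hi : ZMod Q.k → ℤ}

lemma exists_cell_single (hB : GapBounds Q.k lo hi) {w : V} {i : ZMod Q.k}
    (h : Q.W i = .single w) : ∃ m, m ∈ cellArc i 3 5 ∧ Q.IsCommonCell lo hi w w m := by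
  obtain ⟨n, rfl⟩ := ZMod.exists_intCast_eq i
  refine ⟨6 * n + 4, ⟨n, rfl, by omega, by omega⟩, fun j hj _ => ?_⟩
  rw [Q.adj_single_iff h] at hj
  exact hB.mem_core (by norm_num) (by norm_num) hj.1 fun _ => hj.2

lemma exists_cell_side (hB : GapBounds Q.k lo hi) {y : V} {i : ZMod Q.k}
    (h : Q.IsSideWitness y i) :
    ∃ m, m ∈ cellArc i (Q.leftEnd y i) (Q.rightEnd y i) ∧ Q.IsCommonCell lo hi y y m := by
  obtain ⟨n, rfl⟩ := ZMod.exists_intCast_eq i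
  have h1 := leftEnd_bounds y (n : ZMod Q.k)
  have h2 := rightEnd_bounds y (n : ZMod Q.k)
  have h3 := h.leftEnd_le_rightEnd
  refine ⟨6 * n + max 0 (Q.leftEnd y n), ⟨n, rfl, by omega, by omega⟩, fun j hj _ => ?_⟩
  rw [Q.adj_v_iff_ne h.2] at hj
  exact hB.mem_core (by omega) (by omega) hj (by omega)

lemma eq_of_adjacent_cells {i : ZMod Q.k} {n n' : ℤ}
    (h : (n : ZMod Q.k) = i) (h' : (n' : ZMod Q.k) = i) (h1 : n ≤ n' + 1) (h2 : n' ≤ n + 1) :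
    n = n' := by
  subst h
  have e := Q.one_ne_zero
  have h3 : n' = n ∨ n' = n + 1 ∨ n = n' + 1 := by omega
  rcases h3 with rfl | rfl | rfl
  · rfl
  · push_cast at h'
    exact absurd (by simpa using h') e
  · push_cast at h'
    exact absurd (by simpa using h'.symm) e

/-- Side witnesses at the same core vertex meet if and only if they are adjacent. -/
lemma adj_side_side_same (hB : GapBounds Q.k lo hi) {y y' : V} {i : ZMod Q.k}
    (h : Q.IsSideWitness y i) (h' : Q.IsSideWitness y' i) (hne : y ≠ y') :
    (G.Adj y y' → ∃ m, m ∈ cellArc i (Q.leftEnd y i) (Q.rightEnd y i) ∧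
      m ∈ cellArc i (Q.leftEnd y' i) (Q.rightEnd y' i) ∧ Q.IsCommonCell lo hi y y' m) ∧
    (∀ m, m ∈ cellArc i (Q.leftEnd y i) (Q.rightEnd y i) →
      m ∈ cellArc i (Q.leftEnd y' i) (Q.rightEnd y' i) → G.Adj y y') := by
  -- It suffices to treat the case where `y` is the second witness at `i - 1`.
  wlog hw : y ∈ (Q.W (i - 1)).verts ∧ y' ∉ (Q.W (i - 1)).verts ∧ y ∉ (Q.W i).verts ∧
        y' ∈ (Q.W i).verts generalizing y y'
  · have hw' := ((h.eq_or_mem h').resolve_left hne).resolve_left hw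
    obtain ⟨h1, h2⟩ := this h' h hne.symm hw'
    refine ⟨fun hadj => ?_, fun m hm hm' => (h2 m hm' hm).symm⟩
    obtain ⟨m, hm, hm', hm''⟩ := h1 hadj.symm
    exact ⟨m, hm', hm, fun j hj hj' => hm'' j hj' hj⟩
  obtain ⟨hy, hy1, hy2, hy'⟩ := hw
  have hl := leftEnd_of_mem hy
  have hr := rightEnd_of_mem hy'
  obtain ⟨z, hz⟩ := h.right_of_mem hy
  obtain ⟨z', hz'⟩ := h'.left_of_mem hy'
  have hl' : (G.Adj y y' ∧ Q.leftEnd y' i = 1) ∨ (¬ G.Adj y y' ∧ Q.leftEnd y' i = 2) := by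
    rcases leftEnd_cases y' i with ⟨-, e⟩ | ⟨-, w, e, -⟩ | ⟨e1, -, -, x, e2, e3⟩ | ⟨e1, -, -, e2⟩
    · exact absurd e hy1
    · rw [hz] at e
      cases e
    · have : x = y := by
        have e4 := e2.eq_or_mem h
        have e5 := e2.eq_or_mem h'
        have := e3.ne'
        tauto
      subst this
      exact Or.inl ⟨e3.symm, e1⟩
    · exact Or.inr ⟨fun hadj => e2 ⟨y, h, hadj.symm⟩, e1⟩
  have hr' : (G.Adj y y' ∧ Q.rightEnd y i = 1) ∨ (¬ G.Adj y y' ∧ Q.rightEnd y i = 0) := by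
    rcases rightEnd_cases y i with ⟨-, e⟩ | ⟨-, w, e, -⟩ | ⟨e1, -, -, x, e2, e3⟩ | ⟨e1, -, -, e2⟩
    · exact absurd e hy2
    · rw [hz'] at e
      cases e
    · have : x = y' := by
        have e4 := e2.eq_or_mem h
        have e5 := e2.eq_or_mem h'
        have := e3.ne'
        tauto
      subst this
      exact Or.inl ⟨e3, e1⟩
    · exact Or.inr ⟨fun hadj => e2 ⟨y', h', hadj⟩, e1⟩
  rw [hl, hr]
  constructor
  · intro hadj
    obtain ⟨n, rfl⟩ := ZMod.exists_intCast_eq i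
    rcases hl' with ⟨-, hl'⟩ | ⟨h0, -⟩
    swap
    · exact absurd hadj h0
    rcases hr' with ⟨-, hr'⟩ | ⟨h0, -⟩
    swap
    · exact absurd hadj h0
    refine ⟨6 * n + 1, ⟨n, rfl, by omega, by omega⟩, ⟨n, rfl, by omega, by omega⟩,
      fun j hj _ => ?_⟩
    rw [Q.adj_v_iff_ne h.2] at hj
    exact hB.mem_core (by norm_num) (by norm_num) hj (by norm_num)
  · rintro m ⟨n, hn, h1, h2⟩ ⟨n', hn', h3, h4⟩
    rcases hl' with ⟨hadj, -⟩ | ⟨-, hl'⟩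
    · exact hadj
    rcases hr' with ⟨hadj, -⟩ | ⟨-, hr'⟩
    · exact hadj
    have := eq_of_adjacent_cells hn hn' (by omega) (by omega)
    omega

/-- Side witnesses at different core vertices meet if and only if they are adjacent. -/
lemma IsEssential.adj_side_side (hE : Q.IsEssential) (hB : GapBounds Q.k lo hi) {y y' : V}
    {i j : ZMod Q.k} (h : Q.IsSideWitness y i) (h' : Q.IsSideWitness y' j) (hij : i ≠ j) :
    (G.Adj y y' → ∃ m, m ∈ cellArc i (Q.leftEnd y i) (Q.rightEnd y i) ∧
      m ∈ cellArc j (Q.leftEnd y' j) (Q.rightEnd y' j) ∧ Q.IsCommonCell lo hi y y' m) ∧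
    (∀ m, m ∈ cellArc i (Q.leftEnd y i) (Q.rightEnd y i) →
      m ∈ cellArc j (Q.leftEnd y' j) (Q.rightEnd y' j) → G.Adj y y') := by
  have meet : ∀ {y y' : V} {n : ℤ}, Q.IsSideWitness y n → Q.IsSideWitness y' (n + 1) →
      Q.W n = .pair y y' → ∃ m, m ∈ cellArc (n : ZMod Q.k) (Q.leftEnd y n) (Q.rightEnd y n) ∧
      m ∈ cellArc ((n : ZMod Q.k) + 1) (Q.leftEnd y' (n + 1)) (Q.rightEnd y' (n + 1)) ∧
      Q.IsCommonCell lo hi y y' m := by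
    intro y y' n h h' hW
    have hr : Q.rightEnd y n = 4 := rightEnd_of_mem (by rw [hW]; exact Or.inl rfl)
    have hl : Q.leftEnd y' (n + 1) = -2 :=
      leftEnd_of_mem (by rw [add_sub_cancel_right, hW]; exact Or.inr rfl)
    have h1 := leftEnd_bounds y (n : ZMod Q.k)
    have h2 := rightEnd_bounds y' ((n : ZMod Q.k) + 1)
    refine ⟨6 * n + 4, ⟨n, rfl, by omega, by omega⟩, ⟨n + 1, by push_cast; rfl, by omega, by omega⟩,
      fun j hj hj' => ?_⟩
    rw [Q.adj_v_iff_ne h.2] at hj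
    rw [Q.adj_v_iff_ne h'.2] at hj'
    exact hB.mem_core (by norm_num) (by norm_num) hj fun _ => hj'
  have adj : ∀ {y y' : V} {n n' m : ℤ}, Q.IsSideWitness y n → Q.IsSideWitness y' n' → n < n' →
      m - 6 * n ≤ Q.rightEnd y n → Q.leftEnd y' n' ≤ m - 6 * n' → G.Adj y y' := by
    intro y y' n n' m h h' hlt h1 h2
    have h3 := leftEnd_bounds y' (n' : ZMod Q.k)
    have h4 := rightEnd_bounds y (n : ZMod Q.k)
    obtain rfl : n' = n + 1 := by omega
    obtain ⟨z, hz⟩ := h.left_of_mem (mem_of_le_rightEnd (by omega))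
    obtain ⟨z', hz'⟩ := h'.right_of_mem (mem_of_le_leftEnd (by omega))
    push_cast at hz'
    rw [add_sub_cancel_right, hz] at hz'
    injection hz' with _ e
    subst e
    exact Q.adj_pair hz
  constructor
  · intro hadj
    rcases hE.side_side h h' hij hadj with ⟨rfl, hW⟩ | ⟨rfl, hW⟩
    · obtain ⟨n, rfl⟩ := ZMod.exists_intCast_eq i
      exact meet h h' hW
    · obtain ⟨n, rfl⟩ := ZMod.exists_intCast_eq j
      obtain ⟨m, h1, h2, h3⟩ := meet h' h hW
      exact ⟨m, h2, h1, fun j hj hj' => h3 j hj' hj⟩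
  · rintro m ⟨n, rfl, h1, h2⟩ ⟨n', rfl, h3, h4⟩
    rcases lt_trichotomy n n' with hlt | rfl | hlt
    · exact adj h h' hlt h2 h3
    · exact absurd rfl hij
    · exact (adj h' h hlt h4 h1).symm

/-- A single witness meets a side witness if and only if they are adjacent. -/
lemma IsEssential.adj_single_side (hE : Q.IsEssential) (hB : GapBounds Q.k lo hi) {w y : V}
    {i j : ZMod Q.k} (h : Q.W i = .single w) (h' : Q.IsSideWitness y j) :
    (G.Adj w y → ∃ m, m ∈ cellArc i 3 5 ∧
      m ∈ cellArc j (Q.leftEnd y j) (Q.rightEnd y j) ∧ Q.IsCommonCell lo hi w y m) ∧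
    (∀ m, m ∈ cellArc i 3 5 → m ∈ cellArc j (Q.leftEnd y j) (Q.rightEnd y j) → G.Adj w y) := by
  have hl := leftEnd_bounds y j
  have hr := rightEnd_bounds y j
  have hyi : y ∉ (Q.W i).verts := by
    rw [h]
    rintro (rfl : y = w)
    exact h'.not_single h
  constructor
  · intro hadj
    rcases hE.single_side h h' hadj with rfl | rfl
    · have h3 : Q.rightEnd y j = 3 := (if_neg hyi).trans (if_pos ⟨w, h, hadj⟩)
      obtain ⟨n, rfl⟩ := ZMod.exists_intCast_eq j
      refine ⟨6 * n + 3, ⟨n, rfl, by omega, by omega⟩, ⟨n, rfl, by omega, by omega⟩,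
        fun l hl _ => ?_⟩
      rw [Q.adj_single_iff h] at hl
      exact hB.mem_core (by norm_num) (by norm_num) hl.1 fun _ => hl.2
    · have h3 : Q.leftEnd y (i + 1) = -1 := by
        unfold leftEnd
        rw [add_sub_cancel_right]
        exact (if_neg hyi).trans (if_pos ⟨w, h, hadj⟩)
      obtain ⟨n, rfl⟩ := ZMod.exists_intCast_eq i
      refine ⟨6 * n + 5, ⟨n, rfl, by omega, by omega⟩,
        ⟨n + 1, by push_cast; rfl, by omega, by omega⟩, fun l hl _ => ?_⟩
      rw [Q.adj_single_iff h] at hl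
      exact hB.mem_core (by norm_num) (by norm_num) hl.1 fun _ => hl.2
  · rintro m ⟨n, rfl, h1, h2⟩ ⟨n', rfl, h3, h4⟩
    have h5 : n' = n ∨ n' = n + 1 := by omega
    rcases h5 with rfl | rfl
    · rcases rightEnd_cases y (n' : ZMod Q.k) with ⟨-, e⟩ | ⟨-, w', e, e'⟩ | e | e
      · exact absurd e hyi
      · rw [h] at e
        injection e with e
        exact e ▸ e'
      · omega
      · omega
    · rcases leftEnd_cases y ((n + 1 : ℤ) : ZMod Q.k) with ⟨-, e⟩ | ⟨-, w', e, e'⟩ | e | e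
      · push_cast at e
        rw [add_sub_cancel_right] at e
        exact absurd e hyi
      · push_cast at e
        rw [add_sub_cancel_right, h] at e
        injection e with e
        exact e ▸ e'
      · omega
      · omega

/-- The arcs of different single witnesses do not meet. -/
lemma eq_of_mem_cellArc_single {w w' : V} {i j : ZMod Q.k} (h : Q.W i = .single w)
    (h' : Q.W j = .single w') {m : ℤ} (hm : m ∈ cellArc i 3 5) (hm' : m ∈ cellArc j 3 5) :
    w = w' := by
  obtain ⟨n, rfl, h1, h2⟩ := hm
  obtain ⟨n', rfl, h3, h4⟩ := hm'
  obtain rfl : n = n' := by omega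
  rw [h] at h'
  injection h'

end ObstacleEnumeration

/-! ### The model and its cliques -/

namespace ObstacleEnumeration

variable {V : Type u} {G : SimpleGraph V} {Q : ObstacleEnumeration G} {lo hi : ZMod Q.k → ℤ}

/-- The gaps contain the arcs of the nonadjacent witnesses in `S`. -/
structure GapsContain (Q : ObstacleEnumeration G) (lo hi : ZMod Q.k → ℤ) (S : Set V) : Prop where
  side : ∀ y ∈ S, ∀ i, Q.IsSideWitness y i → lo i ≤ Q.leftEnd y i ∧ Q.rightEnd y i ≤ hi i
  single : ∀ w ∈ S, ∀ i, Q.W i = .single w → hi i = 5 ∧ lo (i + 1) = -3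

lemma Located.le (hB : GapBounds Q.k lo hi) {y : V} {i : ZMod Q.k} {L R : ℤ}
    (h : Located Q lo hi y i L R) : L ≤ R := by
  cases h with
  | core =>
    have h1 := hB.le_lo i
    have h2 := hB.hi_le i
    have h3 := hB.three_le
    omega
  | single => norm_num
  | side _ _ h => exact h.leftEnd_le_rightEnd

lemma exists_located (hspan : Q.IsSpanning) (y : V) : ∃ i L R, Located Q lo hi y i L R := by
  have hy : y ∈ Q.core ∪ Q.witnesses := hspan ▸ Set.mem_univ y
  rcases hy with ⟨j, rfl⟩ | hy
  · exact ⟨_, _, _, .core j⟩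
  · rcases cases_of_mem_witnesses hy with ⟨i, hi⟩ | ⟨i, hi⟩
    · exact ⟨_, _, _, .single _ _ hi⟩
    · exact ⟨_, _, _, .side _ _ hi⟩

lemma notMem_core_of_mem_witnesses {y : V} (h : y ∈ Q.witnesses) (j : ZMod Q.k) : y ≠ Q.v j := by
  rcases cases_of_mem_witnesses h with ⟨i, hi⟩ | ⟨i, hi⟩
  · exact Q.single_ne_v hi j
  · exact Q.ne_v (Set.singleton_nonempty _) hi.2 j

/-- The arc of a witness contains a cell common to all the core vertices adjacent to it. -/
lemma exists_commonCell_self (hB : GapBounds Q.k lo hi) {y : V} {i : ZMod Q.k} {L R : ℤ}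
    (h : Located Q lo hi y i L R) (hy : y ∈ Q.witnesses) :
    ∃ m, m ∈ cellArc i L R ∧ Q.IsCommonCell lo hi y y m := by
  cases h with
  | core => exact absurd rfl (notMem_core_of_mem_witnesses hy i)
  | single _ _ h => exact exists_cell_single hB h
  | side _ _ h => exact exists_cell_side hB h

/-- The arcs of two adjacent witnesses meet in a cell common to all the core vertices adjacent to
both of them. -/
lemma IsEssential.exists_commonCell (hE : Q.IsEssential) (hB : GapBounds Q.k lo hi) {y y' : V}
    {i j : ZMod Q.k} {L R L' R' : ℤ} (h : Located Q lo hi y i L R)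
    (h' : Located Q lo hi y' j L' R') (hy : y ∈ Q.witnesses) (hy' : y' ∈ Q.witnesses)
    (hadj : G.Adj y y') :
    ∃ m, m ∈ cellArc i L R ∧ m ∈ cellArc j L' R' ∧ Q.IsCommonCell lo hi y y' m := by
  cases h with
  | core => exact absurd rfl (notMem_core_of_mem_witnesses hy i)
  | single _ _ h =>
    cases h' with
    | core => exact absurd rfl (notMem_core_of_mem_witnesses hy' j)
    | single _ _ h' => exact absurd hadj (hE.single_single h h')
    | side _ _ h' => exact (hE.adj_single_side hB h h').1 hadj
  | side _ _ h =>
    cases h' with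
    | core => exact absurd rfl (notMem_core_of_mem_witnesses hy' j)
    | single _ _ h' =>
      obtain ⟨m, h1, h2, h3⟩ := (hE.adj_single_side hB h' h).1 hadj.symm
      exact ⟨m, h2, h1, fun l hl hl' => h3 l hl' hl⟩
    | side _ _ h' =>
      by_cases hij : i = j
      · subst hij
        exact (adj_side_side_same hB h h' hadj.ne).1 hadj
      · exact (hE.adj_side_side hB h h' hij).1 hadj

/-- The arc of a witness in `S` meets the arc of a core vertex if and only if they are adjacent. -/
lemma Located.adj_core (hB : GapBounds Q.k lo hi) {S : Set V} (hS : GapsContain Q lo hi S)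
    {y : V} (hyS : y ∈ S) {i j : ZMod Q.k} {L R : ℤ} (h : Located Q lo hi y i L R)
    (hy : y ∈ Q.witnesses) : G.Adj y (Q.v j) ↔
      ∃ m, m ∈ cellArc i L R ∧ m ∈ cellArc j (hi j + 1) (6 * Q.k + lo j - 1) := by
  constructor
  · intro hadj
    obtain ⟨m, h1, h2⟩ := exists_commonCell_self hB h hy
    exact ⟨m, h1, h2 j hadj hadj⟩
  · rintro ⟨m, h1, h2⟩
    by_contra hadj
    cases h with
    | core => exact absurd rfl (notMem_core_of_mem_witnesses hy i)
    | single _ _ h =>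
      rw [Q.adj_single_iff h] at hadj
      obtain ⟨hs1, hs2⟩ := hS.single y hyS i h
      obtain ⟨n, rfl, h3, h4⟩ := h1
      by_cases hj : j = n
      · subst hj
        have := hB.lo_le n
        exact hB.notMem_core rfl (by omega) (by omega) h2
      · obtain rfl : j = (n : ZMod Q.k) + 1 := by tauto
        have := hB.le_hi ((n : ZMod Q.k) + 1)
        exact hB.notMem_core (n := n + 1) (by push_cast; rfl) (by omega) (by omega) h2
    | side _ _ h =>
      rw [Q.adj_v_iff_ne h.2, not_not] at hadj
      subst hadj
      obtain ⟨hs1, hs2⟩ := hS.side y hyS j h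
      obtain ⟨n, rfl, h3, h4⟩ := h1
      exact hB.notMem_core rfl (by omega) (by omega) h2

/-- The arcs of two vertices in `S` meet if and only if the vertices are adjacent. -/
lemma IsEssential.adj_iff_of_located (hE : Q.IsEssential) (hB : GapBounds Q.k lo hi) {S : Set V}
    (hS : GapsContain Q lo hi S) {y y' : V} (hyS : y ∈ S) (hyS' : y' ∈ S) (hne : y ≠ y')
    {i j : ZMod Q.k} {L R L' R' : ℤ} (h : Located Q lo hi y i L R)
    (h' : Located Q lo hi y' j L' R') :
    G.Adj y y' ↔ ∃ m, m ∈ cellArc i L R ∧ m ∈ cellArc j L' R' := by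
  have wit_single : ∀ {w : V} {i : ZMod Q.k}, Q.W i = .single w → w ∈ Q.witnesses := fun h =>
    mem_witnesses (by rw [h]; rfl)
  have core_left : ∀ {y : V} {i j : ZMod Q.k} {L R : ℤ}, y ∈ S → Located Q lo hi y i L R →
      y ∈ Q.witnesses → (G.Adj (Q.v j) y ↔
      ∃ m, m ∈ cellArc j (hi j + 1) (6 * Q.k + lo j - 1) ∧ m ∈ cellArc i L R) := by
    intro y i j L R hyS h hy
    rw [SimpleGraph.adj_comm, h.adj_core hB hS hyS hy]
    exact exists_congr fun m => and_comm
  cases h with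
  | core =>
    cases h' with
    | core => exact ⟨fun _ => hB.exists_mem_core_core i j,
        fun _ => Q.isClique ⟨i, rfl⟩ ⟨j, rfl⟩ hne⟩
    | single _ _ h' => exact core_left hyS' (.single _ _ h') (wit_single h')
    | side _ _ h' => exact core_left hyS' (.side _ _ h') h'.1
  | single _ _ h =>
    cases h' with
    | core => exact (Located.single _ _ h).adj_core hB hS hyS (wit_single h)
    | single _ _ h' =>
      exact ⟨fun hadj => absurd hadj (hE.single_single h h'),
        fun ⟨m, h1, h2⟩ => absurd (eq_of_mem_cellArc_single h h' h1 h2) hne⟩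
    | side _ _ h' =>
      exact ⟨fun hadj => ((hE.adj_single_side hB h h').1 hadj).imp fun m hm => ⟨hm.1, hm.2.1⟩,
        fun ⟨m, h1, h2⟩ => (hE.adj_single_side hB h h').2 m h1 h2⟩
  | side _ _ h =>
    cases h' with
    | core => exact (Located.side _ _ h).adj_core hB hS hyS h.1
    | single _ _ h' =>
      exact ⟨fun hadj => ((hE.adj_single_side hB h' h).1 hadj.symm).imp
        fun m hm => ⟨hm.2.1, hm.1⟩,
        fun ⟨m, h1, h2⟩ => ((hE.adj_single_side hB h' h).2 m h2 h1).symm⟩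
    | side _ _ h' =>
      by_cases hij : i = j
      · subst hij
        exact ⟨fun hadj => ((adj_side_side_same hB h h' hne).1 hadj).imp
          fun m hm => ⟨hm.1, hm.2.1⟩, fun ⟨m, h1, h2⟩ => (adj_side_side_same hB h h' hne).2 m h1 h2⟩
      · exact ⟨fun hadj => ((hE.adj_side_side hB h h' hij).1 hadj).imp
          fun m hm => ⟨hm.1, hm.2.1⟩, fun ⟨m, h1, h2⟩ => (hE.adj_side_side hB h h' hij).2 m h1 h2⟩

/-- The model of the subgraph induced by `S`.  It is Helly if there are no three pairwise adjacent
witnesses and the core vertices in `S` have a common cell. -/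
theorem IsEssential.exists_model (hE : Q.IsEssential) (hspan : Q.IsSpanning)
    (hB : GapBounds Q.k lo hi) {S : Set V} (hS : GapsContain Q lo hi S) :
    ∃ A, IsCircularArcModel (G.induce S) A ∧
      ((∀ x ∈ S, ∀ y ∈ S, ∀ z ∈ S, x ∈ Q.witnesses → y ∈ Q.witnesses → z ∈ Q.witnesses →
        G.Adj x y → G.Adj x z → ¬ G.Adj y z) →
      (∃ m, ∀ j, Q.v j ∈ S → m ∈ cellArc j (hi j + 1) (6 * Q.k + lo j - 1)) →
      IsHellyFamily A) := by
  choose i L R hloc using exists_located (lo := lo) (hi := hi) hspan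
  have hk := hB.three_le
  obtain ⟨A, hA, hH⟩ := exists_model_of_cells (G := G.induce S) (k := Q.k) (by omega)
    (fun y => i y) (fun y => L y) (fun y => R y) (fun y => (hloc y).le hB) fun y y' hne =>
      hE.adj_iff_of_located hB hS y.2 y'.2 (fun e => hne (Subtype.ext e)) (hloc y) (hloc y')
  refine ⟨A, hA, fun htri ⟨m₀, hm₀⟩ => hH fun K hK => ?_⟩
  have hcore : ∀ j m, m ∈ cellArc j (hi j + 1) (6 * Q.k + lo j - 1) →
      m ∈ cellArc (i (Q.v j)) (L (Q.v j)) (R (Q.v j)) := by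
    intro j m hm
    have h := hloc (Q.v j)
    generalize hyj : Q.v j = y at h
    generalize i y = i', L y = L', R y = R' at h
    cases h with
    | core j' =>
      obtain rfl := Q.injective hyj
      exact hm
    | single _ _ h => exact absurd hyj.symm (Q.single_ne_v h j)
    | side _ _ h => exact absurd hyj.symm (notMem_core_of_mem_witnesses h.1 j)
  have hadj : ∀ {y y' : S}, y ∈ K → y' ∈ K → (y : V) ≠ y' → G.Adj y y' := fun hy hy' hne =>
    hK hy hy' fun e => hne (congrArg Subtype.val e)
  -- A common cell of the witnesses `y` and `y'` in the clique is also common to the core vertices.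
  have hfin : ∀ {y y' : S} {m : ℤ}, y ∈ K → y' ∈ K → (y : V) ∈ Q.witnesses →
      (y' : V) ∈ Q.witnesses → Q.IsCommonCell lo hi y y' m →
      (∀ x ∈ K, (x : V) ∈ Q.witnesses → m ∈ cellArc (i x) (L x) (R x)) →
      ∀ x ∈ K, m ∈ cellArc (i x) (L x) (R x) := by
    intro y y' m hy hy' hyw hyw' hm hw x hx
    have hxu : (x : V) ∈ Q.core ∪ Q.witnesses := hspan ▸ Set.mem_univ _
    rcases hxu with ⟨j, hj⟩ | hxw
    · rw [← hj]
      refine hcore j m (hm j ?_ ?_)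
      · rw [hj]
        exact hadj hy hx (hj ▸ notMem_core_of_mem_witnesses hyw j)
      · rw [hj]
        exact hadj hy' hx (hj ▸ notMem_core_of_mem_witnesses hyw' j)
    · exact hw x hx hxw
  by_cases h1 : ∃ y ∈ K, (y : V) ∈ Q.witnesses
  · obtain ⟨y, hy, hyw⟩ := h1
    by_cases h2 : ∃ y' ∈ K, (y' : V) ∈ Q.witnesses ∧ (y : V) ≠ y'
    · obtain ⟨y', hy', hyw', hne⟩ := h2
      obtain ⟨m, hm1, hm2, hm3⟩ :=
        hE.exists_commonCell hB (hloc y) (hloc y') hyw hyw' (hadj hy hy' hne)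
      refine ⟨m, hfin hy hy' hyw hyw' hm3 fun x hx hxw => ?_⟩
      by_cases e : (y : V) = x
      · exact e ▸ hm1
      by_cases e' : (y' : V) = x
      · exact e' ▸ hm2
      exact absurd (hadj hy' hx e') (htri y y.2 y' y'.2 x x.2 hyw hyw' hxw (hadj hy hy' hne)
        (hadj hy hx e))
    · obtain ⟨m, hm1, hm2⟩ := exists_commonCell_self hB (hloc y) hyw
      refine ⟨m, hfin hy hy hyw hyw hm2 fun x hx hxw => ?_⟩
      by_cases e : (y : V) = x
      · exact e ▸ hm1
      · exact absurd ⟨x, hx, hxw, e⟩ h2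
  · refine ⟨m₀, fun x hx => ?_⟩
    have hxu : (x : V) ∈ Q.core ∪ Q.witnesses := hspan ▸ Set.mem_univ _
    rcases hxu with ⟨j, hj⟩ | hxw
    · rw [← hj]
      exact hcore j m₀ (hm₀ j (hj ▸ x.2))
    · exact absurd ⟨x, hx, hxw⟩ h1

/-- The gaps of the default model. -/
lemma gapBounds_default (Q : ObstacleEnumeration G) :
    GapBounds Q.k (fun _ => -3) (fun _ => 5) :=
  ⟨Q.three_le, by simp, by simp, by simp, by simp⟩

lemma gapsContain_default (Q : ObstacleEnumeration G) (S : Set V) :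
    GapsContain Q (fun _ => -3) (fun _ => 5) S := by
  refine ⟨fun y _ i _ => ?_, fun _ _ _ _ => ⟨rfl, rfl⟩⟩
  have := leftEnd_bounds y i
  have := rightEnd_bounds y i
  constructor <;> omega

theorem IsEssential.isCircularArcGraph (hE : Q.IsEssential) (hspan : Q.IsSpanning) :
    IsCircularArcGraph G := by
  obtain ⟨A, hA, -⟩ := hE.exists_model hspan Q.gapBounds_default (Q.gapsContain_default Set.univ)
  refine ⟨fun v => A ⟨v, trivial⟩, fun v => hA.1 _, fun u v huv => ?_⟩
  rw [← hA.2 _ _ fun e => huv (congrArg Subtype.val e)]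
  rfl

/-! ### Proper induced subgraphs of essential obstacles -/

/-- If a witness of the `i₀`-th edge is removed, the arcs of the two ends of this edge can be
extended to the cell `6 * i₀ + t`, where `t` depends on the position of the removed witness. -/
theorem IsEssential.isHelly_of_witness_notMem (hE : Q.IsEssential) (hspan : Q.IsSpanning)
    {S : Set V} {x : V} (hx : x ∈ Q.witnesses) (hxS : x ∉ S) :
    IsHellyCircularArcGraph (G.induce S) := by
  obtain ⟨i₀, hi₀⟩ := Set.mem_iUnion.1 hx
  have key : ∃ t : ℤ, 3 ≤ t ∧ t ≤ 5 ∧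
      (∀ y ∈ S, Q.IsSideWitness y i₀ → Q.rightEnd y i₀ < t) ∧
      (∀ y ∈ S, Q.IsSideWitness y (i₀ + 1) → t - 6 < Q.leftEnd y (i₀ + 1)) ∧
      ∀ w ∈ S, Q.W i₀ ≠ .single w := by
    have hlt : ∀ {y : V} {i : ZMod Q.k} {t : ℤ}, Q.IsSideWitness y i → y ∉ (Q.W i).verts →
        ((3 < t) ∨ 3 ≤ t ∧ ∃ a b, Q.W i = .pair a b) → Q.rightEnd y i < t := by
      intro y i t h h1 h2
      rcases rightEnd_cases y i with e | ⟨e, w, hw, -⟩ | e | e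
      · exact absurd e.2 h1
      · rcases h2 with h2 | ⟨-, a, b, hab⟩
        · omega
        · rw [hw] at hab
          cases hab
      · omega
      · omega
    have hgt : ∀ {y : V} {i : ZMod Q.k} {t : ℤ}, Q.IsSideWitness y (i + 1) → y ∉ (Q.W i).verts →
        ((t < 5) ∨ t ≤ 5 ∧ ∃ a b, Q.W i = .pair a b) → t - 6 < Q.leftEnd y (i + 1) := by
      intro y i t h h1 h2
      have h3 := leftEnd_cases y (i + 1)
      rw [add_sub_cancel_right] at h3
      rcases h3 with e | ⟨e, w, hw, -⟩ | e | e
      · exact absurd e.2 h1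
      · rcases h2 with h2 | ⟨-, a, b, hab⟩
        · omega
        · rw [hw] at hab
          cases hab
      · omega
      · omega
    have hmem : ∀ {y : V} {i j : ZMod Q.k}, Q.IsSideWitness y i → ∀ {w}, Q.W j = .single w →
        y ∉ (Q.W j).verts := by
      intro y i j h w hw hy
      rw [hw] at hy
      obtain rfl : y = w := hy
      exact h.not_single hw
    cases hW : Q.W i₀ with
    | single w =>
      rw [hW] at hi₀
      obtain rfl : x = w := hi₀
      refine ⟨4, by norm_num, by norm_num, fun y _ h => hlt h (hmem h hW) (by norm_num),
        fun y _ h => hgt h (hmem h hW) (by norm_num), fun w hw e => ?_⟩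
      injection e with e
      exact hxS (e ▸ hw)
    | pair a b =>
      rw [hW] at hi₀
      have hp : ∃ a b, Q.W i₀ = .pair a b := ⟨a, b, hW⟩
      rcases hi₀ with rfl | rfl
      · refine ⟨3, by norm_num, by norm_num, fun y hy h => hlt h (fun hmem => ?_)
          (Or.inr ⟨le_rfl, hp⟩), fun y _ h => ?_, fun w _ e => by cases e⟩
        · obtain ⟨z, hz⟩ := h.left_of_mem hmem
          rw [hW] at hz
          injection hz with e _
          exact hxS (e ▸ hy)
        · have := leftEnd_bounds y (i₀ + 1)
          omega
      · refine ⟨5, by norm_num, by norm_num, fun y _ h => ?_, fun y hy h => hgt h (fun hmem => ?_)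
          (Or.inr ⟨le_rfl, hp⟩), fun w _ e => by cases e⟩
        · have := rightEnd_bounds y i₀
          omega
        · obtain ⟨z, hz⟩ := h.right_of_mem (by rwa [add_sub_cancel_right])
          rw [add_sub_cancel_right, hW] at hz
          injection hz with _ e
          exact hxS (e ▸ hy)
  obtain ⟨t, ht3, ht5, hr, hl, hs⟩ := key
  classical
  obtain ⟨lo, hlo⟩ : ∃ lo : ZMod Q.k → ℤ, lo = fun i => if i = i₀ + 1 then t - 5 else -3 := ⟨_, rfl⟩
  obtain ⟨hi, hhi⟩ : ∃ hi : ZMod Q.k → ℤ, hi = fun i => if i = i₀ then t - 1 else 5 := ⟨_, rfl⟩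
  have hB : GapBounds Q.k lo hi := by
    refine ⟨Q.three_le, ?_, ?_, ?_, ?_⟩ <;> intro i <;> simp only [hlo, hhi] <;> split_ifs <;> omega
  have hS : GapsContain Q lo hi S := by
    refine ⟨fun y hy i h => ?_, fun w hw i h => ?_⟩
    · have h1 := leftEnd_bounds y i
      have h2 := rightEnd_bounds y i
      simp only [hlo, hhi]
      constructor
      · split_ifs with e
        · subst e
          have := hl y hy h
          omega
        · omega
      · split_ifs with e
        · subst e
          have := hr y hy h
          omega
        · omega
    · have hne : i ≠ i₀ := by
        rintro rfl
        exact hs w hw h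
      simp [hlo, hhi, hne]
  obtain ⟨A, hA, hH⟩ := hE.exists_model hspan hB hS
  refine ⟨A, hA, hH ?_ ?_⟩
  · intro a ha b hb c hc haw hbw hcw hab hac hbc
    obtain ⟨-, f, hf, hf'⟩ := hE.triangle haw hbw hcw hab hac hbc
    have hfS : ∀ i, f i ∈ S := by
      intro i
      rcases hf' i with e | e | e <;> rw [e] <;> assumption
    rw [hf i₀] at hi₀
    rcases hi₀ with rfl | rfl
    · exact hxS (hfS _)
    · exact hxS (hfS _)
  · obtain ⟨n, rfl⟩ := ZMod.exists_intCast_eq i₀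
    have hk := Q.three_le
    refine ⟨6 * n + t, fun j _ => ?_⟩
    by_cases h1 : j = n
    · subst h1
      have e1 : hi n = t - 1 := by simp [hhi]
      have e2 : lo n = -3 := by simp [hlo, (Q.add_one_ne _).symm]
      exact ⟨n, rfl, by omega, by omega⟩
    by_cases h2 : j = (n : ZMod Q.k) + 1
    · subst h2
      have e1 : hi (n + 1) = 5 := by simp [hhi, Q.one_ne_zero]
      have e2 : lo (n + 1) = t - 5 := by simp [hlo]
      -- The gap begins at `6 * (n + 1) + t - 5`, just after the cell `6 * n + t`.
      exact ⟨n + 1 - Q.k, by simp, by omega, by omega⟩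
    exact hB.mem_core (by omega) ht5 h1 fun _ => h2

/-- If all witnesses form a cycle of pairs `f i`, `f (i + 1)` over a core of three vertices, then
the roles of core and witnesses can be exchanged. -/
lemma exists_exchange (hspan : Q.IsSpanning) (hk : Q.k = 3) {f : ZMod Q.k → V}
    (hf : ∀ i, Q.W i = .pair (f i) (f (i + 1))) (hcl : G.IsClique (Set.range f)) :
    ∃ Q' : ObstacleEnumeration G, Q'.IsSpanning ∧ Q'.IsEssential ∧ ∀ j, Q.v j ∈ Q'.witnesses := by
  have hall : ∀ n : ℕ, n = 3 → ∀ i j : ZMod n, i = j ∨ j = i + 1 ∨ i = j + 1 := by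
    rintro n rfl
    decide
  have hside : ∀ i, Q.IsSideWitness (f i) i := fun i => .of_left (hf i)
  have hinj : Function.Injective f := fun i j e => (hside i).index_unique (e ▸ hside j)
  have hconbr : ∀ i, Gᶜ.neighborSet (Q.v i) ∩ Set.range f = {f i} := by
    intro i
    have h1 : ∀ j, Gᶜ.Adj (Q.v i) (f j) ↔ j = i := by
      intro j
      rw [SimpleGraph.compl_adj, SimpleGraph.adj_comm, Q.adj_v_iff_ne (hside j).2, not_not]
      exact ⟨fun h => h.2.symm, fun h =>
        ⟨(notMem_core_of_mem_witnesses (hside j).1 i).symm, h.symm⟩⟩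
    ext y
    constructor
    · rintro ⟨hy, j, rfl⟩
      exact congrArg f ((h1 j).1 hy)
    · rintro rfl
      exact ⟨(h1 i).2 rfl, i, rfl⟩
  let Q' : ObstacleEnumeration G :=
    { k := Q.k
      three_le := Q.three_le
      v := f
      injective := hinj
      isClique := hcl
      W := fun i => .pair (Q.v i) (Q.v (i + 1))
      isWitness := fun i => ⟨hconbr i, hconbr (i + 1), Q.isClique ⟨i, rfl⟩ ⟨i + 1, rfl⟩
        fun e => Q.add_one_ne i (Q.injective e).symm⟩ }
  have hw : ∀ y ∈ Q'.witnesses, ∃ j, y = Q.v j := by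
    intro y hy
    obtain ⟨i, hi⟩ := Set.mem_iUnion.1 hy
    rcases hi with rfl | rfl
    · exact ⟨_, rfl⟩
    · exact ⟨_, rfl⟩
  have hv : ∀ j, Q.v j ∈ Q'.witnesses := fun j => Set.mem_iUnion_of_mem j (Or.inl rfl)
  refine ⟨Q', ?_, ?_, hv⟩
  · refine Set.eq_univ_of_forall fun y => ?_
    have hy : y ∈ Q.core ∪ Q.witnesses := hspan ▸ Set.mem_univ y
    rcases hy with ⟨j, rfl⟩ | hy
    · exact Or.inr (hv j)
    · obtain ⟨i, hi⟩ := Set.mem_iUnion.1 hy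
      rw [hf] at hi
      rcases hi with rfl | rfl
      · exact Or.inl ⟨_, rfl⟩
      · exact Or.inl ⟨_, rfl⟩
  · intro y₁ h₁ y₂ h₂ h12
    obtain ⟨i, rfl⟩ := hw y₁ h₁
    obtain ⟨j, rfl⟩ := hw y₂ h₂
    rcases hall _ hk i j with rfl | rfl | rfl
    · exact absurd rfl h12.ne
    · exact Or.inr (Or.inr ⟨i, Or.inl rfl, Or.inr rfl⟩)
    · exact Or.inr (Or.inr ⟨j, Or.inr rfl, Or.inl rfl⟩)

/-- Proper induced subgraphs of essential obstacles are Helly circular-arc graphs. -/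
theorem IsEssential.isHelly_induce (hE : Q.IsEssential) (hspan : Q.IsSpanning) {S : Set V}
    (hS : S ≠ Set.univ) : IsHellyCircularArcGraph (G.induce S) := by
  obtain ⟨x, hxS⟩ := (Set.ne_univ_iff_exists_notMem S).1 hS
  have hx : x ∈ Q.core ∪ Q.witnesses := hspan ▸ Set.mem_univ x
  rcases hx with ⟨j, rfl⟩ | hx
  swap
  · exact hE.isHelly_of_witness_notMem hspan hx hxS
  by_cases htri : ∃ a b c, a ∈ Q.witnesses ∧ b ∈ Q.witnesses ∧ c ∈ Q.witnesses ∧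
      G.Adj a b ∧ G.Adj a c ∧ G.Adj b c
  · obtain ⟨a, b, c, ha, hb, hc, hab, hac, hbc⟩ := htri
    obtain ⟨hk, f, hf, hf'⟩ := hE.triangle ha hb hc hab hac hbc
    obtain ⟨Q', hspan', hE', hv⟩ := exists_exchange hspan hk hf (by
      rintro _ ⟨i, rfl⟩ _ ⟨l, rfl⟩ hil
      rcases hf' i with e | e | e <;> rcases hf' l with e' | e' | e' <;> rw [e, e'] at hil ⊢ <;>
        first | exact absurd rfl hil | assumption | (apply SimpleGraph.Adj.symm; assumption))
    exact hE'.isHelly_of_witness_notMem hspan' (hv j) hxS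
  · obtain ⟨A, hA, hH⟩ := hE.exists_model hspan Q.gapBounds_default (Q.gapsContain_default S)
    refine ⟨A, hA, hH (fun a _ b _ c _ ha hb hc hab hac hbc =>
      htri ⟨a, b, c, ha, hb, hc, hab, hac, hbc⟩) ?_⟩
    -- A cell that only the gap of the removed core vertex contains.
    obtain ⟨n, rfl⟩ := ZMod.exists_intCast_eq j
    refine ⟨6 * n + 1, fun l hl => ?_⟩
    exact Q.gapBounds_default.mem_core (by norm_num) (by norm_num) (fun e => hxS (e ▸ hl))
      (by norm_num)

end ObstacleEnumeration

/-! ### The characterization -/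

/-- A circular-arc graph that is not Helly has a set of vertices inducing an essential obstacle. -/
lemma IsCircularArcGraph.exists_isEssentialObstacle {V : Type u} [Finite V] {G : SimpleGraph V}
    (h : IsCircularArcGraph G) (hG : ¬ IsHellyCircularArcGraph G) :
    IsEssentialObstacle G ∨ ∃ S : Set V, S ≠ Set.univ ∧ IsEssentialObstacle (G.induce S) := by
  obtain ⟨Q, hE⟩ := h.exists_isEssential hG
  by_cases hS : Q.core ∪ Q.witnesses = Set.univ
  · exact Or.inl ⟨Q, hS, hE⟩
  · exact Or.inr ⟨_, hS, Q.exists_induce rfl hE⟩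

theorem theorem2 {V : Type u} [Finite V] (G : SimpleGraph V) :
    ((IsMinimalForbiddenInducedSubgraph IsHellyCircularArcGraph G ∧ IsCircularArcGraph G) ↔
      IsEssentialObstacle G) ∧
    (IsEssentialObstacle G ↔ (IsMinimalObstacle G ∧ IsCircularArcGraph G)) := by
  refine ⟨⟨?_, ?_⟩, ⟨?_, ?_⟩⟩
  · rintro ⟨⟨hG, hmin⟩, hca⟩
    rcases hca.exists_isEssentialObstacle hG with h | ⟨S, hS, Q, -, -⟩
    · exact h
    · exact absurd (hmin S hS) Q.not_isHellyCircularArcGraph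
  · rintro ⟨Q, hspan, hE⟩
    exact ⟨⟨Q.not_isHellyCircularArcGraph, fun S hS => hE.isHelly_induce hspan hS⟩,
      hE.isCircularArcGraph hspan⟩
  · rintro ⟨Q, hspan, hE⟩
    exact ⟨⟨⟨Q, hspan⟩, fun S hS ⟨Q', _⟩ =>
      Q'.not_isHellyCircularArcGraph (hE.isHelly_induce hspan hS)⟩, hE.isCircularArcGraph hspan⟩
  · rintro ⟨⟨⟨Q₀, -⟩, hmin⟩, hca⟩
    rcases hca.exists_isEssentialObstacle Q₀.not_isHellyCircularArcGraph with
      h | ⟨S, hS, Q, hspan, -⟩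
    · exact h
    · exact absurd ⟨Q, hspan⟩ (hmin S hS)
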